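/- **Setting.** Let $U'\Subset U$ be simply connected regions in $\mathbb C$ and let $f:U'\to U$ be a quadratic-like map, i.e. a holomorphic branched covering of degree two, normalized so that its critical point is $0$. Suppose that its filled Julia set $K(f)=\{z: f^n z\in U',\ n=0,1,\dots\}$ is connected and that both fixed points of $f$ are repelling. Iterates of $f$ are partially defined: $f^n z$ is defined when $f^jz\in U'$ for all $0\le j<n$, and $f^{-n}(A)$ denotes the set of $z$ for which $f^nz$ is defined and lies in $A$. Fix a homeomorphism $h$ from an open neighbourhood of $K(f)$ onto an open neighbourhood of the filled Julia set of a polynomial $P_c(z)=z^2+c$ that maps $K(f)$ onto $K(P_c)$ and satisfies $h\circ f=P_c\circ h$ wherever both sides are defined. External rays and equipotentials of $f$ are the $h$-preimages of those of $P_c$, the latter being defined by the Böttcher function, the conformal isomorphism $B:\mathbb C\setminus K(P_c)\to\{|w|>1\}$ with $B\circ P_c=B^2$ and $B(z)\sim z$ at $\infty$. Let $\alpha$ be the dividing fixed point of $f$, with rotation number $q/p$, $p>1$: exactly $p$ external rays land at $\alpha$, and $f$ permutes them cyclically with combinatorial rotation number $q/p$. Let $E=\{|B\circ h|=r\}$,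 $r>1$, be an equipotential so close to $K(f)$ that the closed region bounded by $\{|B|=r^2\}$ lies in the range of $h$, the closed region bounded by $E$ lies in $U'$, and $f$ maps the latter into the closed region bounded by the equipotential of level $r^2$. The puzzle pieces of depth $0$ are the closures of the components into which the rays landing at $\alpha$ (together with $\alpha$) cut the open region bounded by $E$. The puzzle pieces of depth $n$ are the connected components of the sets $f^{-n}(Y)$, where $Y$ is a puzzle piece of depth $0$. A puzzle piece is a puzzle piece of some depth $n\ge 0$. Let $V$ be a puzzle piece such that $0\in\operatorname{int}V$ and the critical point $0$ returns to $\operatorname{int}V$. Let $k>0$ be the first return time of $0$ to $\operatorname{int}V$, and let $V_0\subset V$ be the puzzle piece containing $0$ with $f^{k}(V_0)=V$ (the central domain of the first return map to $V$). **Lemma 3.5.** Let $z$ be a point whose orbit passes through $\operatorname{int}V_0$, and let $l\ge 0$ be the first moment when $f^l z\in V_0$. Then there is a puzzle piece $\Omega\ni z$ on which $f^l$ is defined and which is mapped by $f^l$ univalently (holomorphically and injectively) onto $V$. -/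

import Mathlib

open Set Filter Topology

/-- The set of points on which the `n`-th iterate of the partial map `f : U' → ℂ` is defined. -/
def iterDomain (f : ℂ → ℂ) (U' : Set ℂ) (n : ℕ) : Set ℂ :=
  {z | ∀ j < n, f^[j] z ∈ U'}

/-- The preimage `f⁻ⁿ(A)` under the `n`-th iterate of the partial map `f : U' → ℂ`. -/
def iterPreimage (f : ℂ → ℂ) (U' : Set ℂ) (n : ℕ) (A : Set ℂ) : Set ℂ :=
  {z | z ∈ iterDomain f U' n ∧ f^[n] z ∈ A}

/-- A topological disk: a simply connected region in `ℂ`. -/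
def IsTopDisk (U : Set ℂ) : Prop :=
  IsOpen U ∧ IsSimplyConnected U

/-- `f : U' → U` is a (Douady-Hubbard) quadratic-like map normalized so that its critical point
is `0`: a holomorphic branched covering of degree two between topological disks `U' ⊂⊂ U`. -/
structure IsQuadraticLike (f : ℂ → ℂ) (U' U : Set ℂ) : Prop where
  disk_domain : IsTopDisk U'
  disk_range : IsTopDisk U
  compact_closure : IsCompact (closure U')
  closure_subset : closure U' ⊆ U
  holo : DifferentiableOn ℂ f U'
  mapsTo : MapsTo f U' U
  proper : IsProperMap (mapsTo.restrict f U' U)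
  zero_mem : (0 : ℂ) ∈ U'
  deriv_zero : deriv f 0 = 0
  /-- The critical value has the critical point as its only preimage. -/
  fiber_crit : ∀ z ∈ U', f z = f 0 → z = 0
  /-- Every other value is taken exactly twice. -/
  fiber_two : ∀ w ∈ U, w ≠ f 0 → {z | z ∈ U' ∧ f z = w}.ncard = 2

/-- The filled Julia set of `f : U' → U`: the set of non-escaping points. -/
def filledJulia (f : ℂ → ℂ) (U' : Set ℂ) : Set ℂ :=
  {z | ∀ n : ℕ, f^[n] z ∈ U'}

/-- The quadratic polynomial `z ↦ z² + c`. -/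
def quadPoly (c : ℂ) (z : ℂ) : ℂ := z ^ 2 + c

/-- The basin of infinity of `z ↦ z² + c`. -/
def basinInfty (c : ℂ) : Set ℂ :=
  {z | Tendsto (fun n : ℕ => (quadPoly c)^[n] z) atTop (cocompact ℂ)}

/-- `B` is the Böttcher function of `z ↦ z² + c` (with connected Julia set): the conformal
isomorphism of the basin of infinity onto `{|w| > 1}` with `B (z² + c) = (B z)²` and `B z ∼ z`
at infinity. -/
structure IsBottcher (c : ℂ) (B : ℂ → ℂ) : Prop where
  holo : DifferentiableOn ℂ B (basinInfty c)
  bij : BijOn B (basinInfty c) {w | 1 < ‖w‖}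
  conj : ∀ z ∈ basinInfty c, B (quadPoly c z) = B z ^ 2
  asymp : Tendsto (fun z => B z / z) (cocompact ℂ) (𝓝 1)

/-- The external ray of the polynomial `z ↦ z² + c` with angle `t` (measured in turns). -/
def externalRay (c : ℂ) (B : ℂ → ℂ) (t : ℝ) : Set ℂ :=
  {z | z ∈ basinInfty c ∧
    ∃ ρ : ℝ, 1 < ρ ∧ B z = (ρ : ℂ) * Complex.exp (2 * Real.pi * t * Complex.I)}

/-- The external ray with angle `t` lands at `a`: its points tend to `a` as their level `‖B z‖`
decreases to `1`. -/
def RayLandsAt (c : ℂ) (B : ℂ → ℂ) (t : ℝ) (a : ℂ) : Prop :=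
  ∀ ε > 0, ∃ δ > 0, ∀ z ∈ externalRay c B t, ‖B z‖ < 1 + δ → dist z a < ε

/-- The closed region bounded by the equipotential `{‖B z‖ = r}` of `z ↦ z² + c`. -/
def closedLevelRegion (c : ℂ) (B : ℂ → ℂ) (r : ℝ) : Set ℂ :=
  {z | z ∈ basinInfty c → ‖B z‖ ≤ r}

/-- The open region bounded by the equipotential `{‖B z‖ = r}` of `z ↦ z² + c`. -/
def openLevelRegion (c : ℂ) (B : ℂ → ℂ) (r : ℝ) : Set ℂ :=
  {z | z ∈ basinInfty c → ‖B z‖ < r}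

/-- `h` conjugates `f : U' → U` to `z ↦ z² + c` near the filled Julia sets: it is a homeomorphism
(`h.source → h.target`) of a neighbourhood of the one onto a neighbourhood of the other. -/
structure IsStraightening (f : ℂ → ℂ) (U' : Set ℂ) (c : ℂ) (h : OpenPartialHomeomorph ℂ ℂ) :
    Prop where
  subset_source : filledJulia f U' ⊆ h.source
  image_filledJulia : h '' filledJulia f U' = (basinInfty c)ᶜ
  conj : ∀ z ∈ h.source, z ∈ U' → f z ∈ h.source → h (f z) = quadPoly c (h z)

/-- The closed region bounded by the equipotential of level `r` of `f`, i.e. the transport by `h`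
of the one for `z ↦ z² + c`. -/
def closedRegion (c : ℂ) (h : OpenPartialHomeomorph ℂ ℂ) (B : ℂ → ℂ) (r : ℝ) : Set ℂ :=
  {z | z ∈ h.source ∧ h z ∈ closedLevelRegion c B r}

/-- The equipotential `E` of level `r` is so close to the filled Julia set that `E` and `f E`
(the equipotential of level `r²`) are both closed curves in the region where the external
coordinates of `f` are defined. -/
structure IsAdmissibleLevel (f : ℂ → ℂ) (U' : Set ℂ) (c : ℂ) (h : OpenPartialHomeomorph ℂ ℂ)
    (B : ℂ → ℂ) (r : ℝ) : Prop where
  one_lt : 1 < r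
  subset_target : closedLevelRegion c B (r ^ 2) ⊆ h.target
  subset_domain : closedRegion c h B r ⊆ U'
  mapsTo : MapsTo f (closedRegion c h B r) (closedRegion c h B (r ^ 2))

/-- `α` is a fixed point of `f : U' → U` with combinatorial rotation number `q/p`: there are
exactly `p` external rays landing at it, with angles `θ 0 < ⋯ < θ (p - 1)` in `[0, 1)`, and `f`
permutes them cyclically, mapping the `i`-th ray to the `(i + q)`-th one (indices mod `p`). -/
def HasRotationNumber (f : ℂ → ℂ) (U' : Set ℂ) (c : ℂ) (h : OpenPartialHomeomorph ℂ ℂ)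
    (B : ℂ → ℂ) (α : ℂ) (q p : ℕ) : Prop :=
  α ∈ U' ∧ f α = α ∧ Nat.Coprime q p ∧
    ∃ θ : Fin p → ℝ, StrictMono θ ∧ (∀ i, θ i ∈ Ico (0 : ℝ) 1) ∧
      (∀ t ∈ Ico (0 : ℝ) 1, RayLandsAt c B t (h α) ↔ ∃ i, θ i = t) ∧
      ∀ i j : Fin p, ((i : ℕ) + q) % p = j → Int.fract (2 * θ i) = θ j

/-- The domain bounded by the equipotential of level `r` of `f`, cut along the external rays
landing at `α` (and along `α` itself). -/
def cutRegion (c : ℂ) (h : OpenPartialHomeomorph ℂ ℂ) (B : ℂ → ℂ) (α : ℂ) (r : ℝ) : Set ℂ :=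
  {z | z ∈ h.source ∧ h z ∈ openLevelRegion c B r ∧ z ≠ α ∧
    ∀ t : ℝ, RayLandsAt c B t (h α) → h z ∉ externalRay c B t}

/-- The puzzle pieces of depth zero: the closed pieces into which the rays landing at `α` cut the
domain bounded by the equipotential. -/
def IsPuzzlePieceZero (c : ℂ) (h : OpenPartialHomeomorph ℂ ℂ) (B : ℂ → ℂ) (α : ℂ) (r : ℝ)
    (Y : Set ℂ) : Prop :=
  ∃ x ∈ cutRegion c h B α r, Y = closure (connectedComponentIn (cutRegion c h B α r) x)

/-- The puzzle pieces of all depths: the connected components of the sets `f⁻ⁿ(Y)`, where `Y` is a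
puzzle piece of depth zero. -/
def IsPuzzlePiece (f : ℂ → ℂ) (U' : Set ℂ) (c : ℂ) (h : OpenPartialHomeomorph ℂ ℂ)
    (B : ℂ → ℂ) (α : ℂ) (r : ℝ) (V : Set ℂ) : Prop :=
  ∃ (n : ℕ) (Y : Set ℂ), IsPuzzlePieceZero c h B α r Y ∧
    ∃ x ∈ iterPreimage f U' n Y, V = connectedComponentIn (iterPreimage f U' n Y) x

/-- `k` is the first return time of the point `x ∈ int V` back to `int V`. -/
def IsFirstReturnTime (f : ℂ → ℂ) (U' V : Set ℂ) (x : ℂ) (k : ℕ) : Prop :=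
  x ∈ interior V ∧ IsLeast {k | 0 < k ∧ x ∈ iterPreimage f U' k (interior V)} k

/-- `V₀` is the central domain of the first return map to the puzzle piece `V`: the critical point
`0` returns to `int V`, and `V₀ ⊆ V` is the puzzle piece containing `0` that is mapped onto `V` by
the iterate `f^k`, where `k` is the first return time of `0`. -/
def IsCentralDomain (f : ℂ → ℂ) (U' : Set ℂ) (c : ℂ) (h : OpenPartialHomeomorph ℂ ℂ)
    (B : ℂ → ℂ) (α : ℂ) (r : ℝ) (V V₀ : Set ℂ) : Prop :=
  IsPuzzlePiece f U' c h B α r V₀ ∧ (0 : ℂ) ∈ V₀ ∧ V₀ ⊆ V ∧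
    ∃ k, IsFirstReturnTime f U' V 0 k ∧ V₀ ⊆ iterDomain f U' k ∧ f^[k] '' V₀ = V

/-- `f^l` is defined on `Ω` and maps it univalently onto `V`. -/
def MapsUnivalentlyOnto (f : ℂ → ℂ) (U' : Set ℂ) (l : ℕ) (Ω V : Set ℂ) : Prop :=
  Ω ⊆ iterDomain f U' l ∧ AnalyticOnNhd ℂ f^[l] Ω ∧ InjOn f^[l] Ω ∧ f^[l] '' Ω = V

/-! Write `V` as a component of $f^{-n}(Y)$ with `Y` of depth zero, and let `Ω` be the component of
$f^{-(n+l)}(Y)$ containing `z`. Its image under $f^{l-i}$ lies in the component $\Omega_i$ of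
$f^{-(n+i)}(Y)$ at $f^{l-i}z$. It suffices that $0\notin\Omega_i$ for $1\le i\le l$, since $f$ is
then injective at every step. If $0\in\Omega_i$ with $i<k$, then $f^i 0\in V$ before the first
return time, which is impossible. If $0\in\Omega_i$ with $i\ge k$, then $\Omega_i$ is a piece around
$0$ of depth at least $n+k$, hence inside `V₀`, so $f^{l-i}z\in V_0$ earlier than time $l$.

Three facts about pieces carry this. Pieces are full continua, and a full continuum symmetric about
$0$ contains $0$; as $P_c(u)=P_c(v)$ means $v=\pm u$, the polynomial is injective on pieces of
positive depth avoiding $0$ (`IsFull.zero_mem_of_neg_mem`, `IsPolyPieceZero.injOn_component`).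
Pieces are nested (`IsPolyPieceZero.exists_superset`), although being closed they may touch along
boundaries. Components of preimages map onto (`IsOpenMap.image_connectedComponentIn_preimage`).

All of this is done for $P_c$, a globally defined map, in `IsPolyPiece.injOn_and_image_eq`, and
carried to $f$ by `h`. The transfer works because the closed region bounded by the equipotential is
backward invariant under $f$. -/

/-! ### Connected components of preimages -/

theorem IsPreconnected.subset_of_disjoint_frontier {X : Type*} [TopologicalSpace X] {S D : Set X}
    (hS : IsPreconnected S) (hD : IsOpen D) (hne : (S ∩ D).Nonempty)
    (hfr : Disjoint S (frontier D)) : S ⊆ D := by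
  refine hS.subset_left_of_subset_union hD isClosed_closure.isOpen_compl
    (disjoint_compl_right_iff_subset.2 subset_closure) (fun x hx => ?_) hne
  by_contra hc
  simp only [mem_union, mem_compl_iff, not_or, not_not] at hc
  exact hfr.notMem_of_mem_left hx ⟨hc.2, by rw [hD.interior_eq]; exact hc.1⟩

theorem IsCompact.connectedComponentIn {X : Type*} [TopologicalSpace X] [T2Space X] {S : Set X}
    (hS : IsCompact S) (x : X) : IsCompact (connectedComponentIn S x) := by
  by_cases hx : x ∈ S
  · rw [connectedComponentIn_eq_image hx]
    have := isCompact_iff_compactSpace.1 hS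
    exact isClosed_connectedComponent.isCompact.image continuous_subtype_val
  · rw [connectedComponentIn_eq_empty hx]
    exact isCompact_empty

/-- A component of the preimage of a connected set under an open map is mapped onto that set, if the
preimage is compact. -/
theorem IsOpenMap.image_connectedComponentIn_preimage {X Y : Type*} [TopologicalSpace X] [T2Space X]
    [TopologicalSpace Y] [T2Space Y] {F : X → Y} (hF : IsOpenMap F) (hc : Continuous F) {T : Set Y}
    (hT : IsPreconnected T) (hK : IsCompact (F ⁻¹' T)) {x : X} (hx : F x ∈ T) :
    F '' connectedComponentIn (F ⁻¹' T) x = T := by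
  have := isCompact_iff_compactSpace.1 hK
  have hpT : PreconnectedSpace T := isPreconnected_iff_preconnectedSpace.1 hT
  set x' : F ⁻¹' T := ⟨x, hx⟩
  let g : F ⁻¹' T → T := T.restrictPreimage F
  have hg : IsOpenMap g := hF.restrictPreimage T
  have hgc : Continuous g := hc.restrictPreimage
  -- A clopen part of the compact preimage has image both open and compact in the connected set `T`.
  -- The component is the intersection of the clopen sets around `x`, so compactness yields one
  -- point over `w` common to all of them.
  have hsurj : ∀ Q : Set (F ⁻¹' T), IsClopen Q → Q.Nonempty → g '' Q = univ := by
    intro Q hQ hne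
    exact IsClopen.eq_univ ⟨(hQ.1.isCompact.image hgc).isClosed, hg _ hQ.2⟩ (hne.image g)
  rw [connectedComponentIn_eq_image (show x ∈ F ⁻¹' T from hx)]
  apply Subset.antisymm
  · rintro _ ⟨_, ⟨y, -, rfl⟩, rfl⟩
    exact y.2
  intro w hw
  have hne : (⋂ s : { s : Set (F ⁻¹' T) // IsClopen s ∧ x' ∈ s },
      (s : Set (F ⁻¹' T)) ∩ g ⁻¹' {⟨w, hw⟩}).Nonempty := by
    have : Nonempty { s : Set (F ⁻¹' T) // IsClopen s ∧ x' ∈ s } :=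
      ⟨⟨univ, isClopen_univ, mem_univ _⟩⟩
    have hcl : ∀ s : { s : Set (F ⁻¹' T) // IsClopen s ∧ x' ∈ s },
        IsClosed ((s : Set (F ⁻¹' T)) ∩ g ⁻¹' {⟨w, hw⟩}) :=
      fun s => s.2.1.1.inter (isClosed_singleton.preimage hgc)
    refine IsCompact.nonempty_iInter_of_directed_nonempty_isCompact_isClosed _ ?_ ?_
      (fun s => (hcl s).isCompact) hcl
    · intro s t
      exact ⟨⟨s ∩ t, s.2.1.inter t.2.1, s.2.2, t.2.2⟩,
        inter_subset_inter_left _ inter_subset_left, inter_subset_inter_left _ inter_subset_right⟩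
    · intro s
      have := hsurj s s.2.1 ⟨x', s.2.2⟩
      obtain ⟨y, hy, hyw⟩ := this.symm ▸ mem_univ (⟨w, hw⟩ : T)
      exact ⟨y, hy, hyw⟩
  obtain ⟨y, hy⟩ := hne
  rw [mem_iInter] at hy
  refine ⟨y, ⟨y, ?_, rfl⟩, congrArg Subtype.val (hy ⟨univ, isClopen_univ, mem_univ _⟩).2⟩
  rw [connectedComponent_eq_iInter_isClopen, mem_iInter]
  exact fun s => (hy s).1

/-! ### Full plane sets and branches of the logarithm -/

/-- A subset of the plane is full if it contains every bounded open set whose frontier it contains,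
i.e. if its complement has no bounded components. -/
def IsFull (T : Set ℂ) : Prop :=
  ∀ D : Set ℂ, IsOpen D → Bornology.IsBounded D → frontier D ⊆ T → D ⊆ T

theorem isOpen_disjoint_frontier {D : Set ℂ} (hD : IsOpen D) : Disjoint D (frontier D) := by
  rw [hD.frontier_eq]; exact disjoint_sdiff_right

/-- For bounded open `D` the image `F '' D` is again bounded and open, and by compactness of
`closure D` its frontier lies in `F '' frontier D`. -/
theorem IsFull.preimage {T : Set ℂ} (hT : IsFull T) {F : ℂ → ℂ} (hF : IsOpenMap F)
    (hc : Continuous F) : IsFull (F ⁻¹' T) := by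
  intro D hD hb hfr
  have hK : IsCompact (closure D) := hb.isCompact_closure
  refine image_subset_iff.1 (hT (F '' D) (hF D hD)
    ((hK.image hc).isBounded.subset (image_mono subset_closure)) ?_)
  rw [(hF D hD).frontier_eq]
  rintro y ⟨hy, hyn⟩
  have : y ∈ F '' closure D :=
    closure_minimal (image_mono subset_closure) (hK.image hc).isClosed hy
  obtain ⟨x, hx, rfl⟩ := this
  refine hfr ⟨hx, fun hxi => hyn ⟨x, interior_subset hxi, rfl⟩⟩

theorem frontier_nonempty_of_isBounded {D : Set ℂ} (hb : Bornology.IsBounded D) (hne : D.Nonempty) :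
    (frontier D).Nonempty := by
  refine nonempty_frontier_iff.2 ⟨hne, ?_⟩
  rintro rfl
  exact NormedSpace.unbounded_univ ℂ ℂ hb

/-- Each component of `D` has nonempty frontier inside the component of `X`, so its closure is a
connected subset of `X` attached to that component. -/
theorem isFull_connectedComponentIn {X : Set ℂ} (hX : IsFull X) (x : ℂ) :
    IsFull (connectedComponentIn X x) := by
  intro D hD hb hfr
  have hDX : D ⊆ X := hX D hD hb (hfr.trans (connectedComponentIn_subset _ _))
  intro d hd
  set D' := connectedComponentIn D d
  have hD' : IsOpen D' := hD.connectedComponentIn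
  have hdD' : d ∈ D' := mem_connectedComponentIn hd
  have hD'D : D' ⊆ D := connectedComponentIn_subset _ _
  have hfr' : frontier D' ⊆ connectedComponentIn X x := by
    intro y hy
    refine hfr ⟨closure_mono hD'D hy.1, fun hyD => ?_⟩
    rw [hD.interior_eq] at hyD
    have ho : IsOpen (connectedComponentIn D y) := hD.connectedComponentIn
    obtain ⟨u, hu1, hu2⟩ := mem_closure_iff.1 hy.1 _ ho (mem_connectedComponentIn hyD)
    have : y ∈ D' := by
      rw [show D' = _ from connectedComponentIn_eq hu2, ← connectedComponentIn_eq hu1]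
      exact mem_connectedComponentIn hyD
    exact (isOpen_disjoint_frontier hD').notMem_of_mem_left this hy
  obtain ⟨y, hy⟩ := frontier_nonempty_of_isBounded (hb.subset hD'D) ⟨d, hdD'⟩
  have hyC := hfr' hy
  rw [connectedComponentIn_eq hyC]
  refine (isPreconnected_connectedComponentIn.closure : IsPreconnected (closure D')
    ).subset_connectedComponentIn hy.1 ?_ (subset_closure hdD')
  rw [closure_eq_self_union_frontier]
  exact union_subset (hD'D.trans hDX) (hfr'.trans (connectedComponentIn_subset _ _))

/-- There is a continuous branch of `log (z - a)` on `T`. -/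
def HasLogBranch (T : Set ℂ) (a : ℂ) : Prop :=
  ∃ g : ℂ → ℂ, ContinuousOn g T ∧ ∀ z ∈ T, Complex.exp (g z) = z - a

/-- The quotient $(z-b)/(z-a)$ stays within distance less than $1$ of $1$, so its principal
logarithm corrects the branch for `a`. -/
theorem HasLogBranch.of_dist_lt {T : Set ℂ} {a b : ℂ} (ha : HasLogBranch T a)
    (hab : ∀ z ∈ T, dist b a < dist z a) : HasLogBranch T b := by
  obtain ⟨g, hg, hgT⟩ := ha
  have hne : ∀ z ∈ T, z - a ≠ 0 := fun z hz => by
    rw [← hgT z hz]; exact Complex.exp_ne_zero _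
  have hs : ∀ z ∈ T, (z - b) / (z - a) ∈ Complex.slitPlane := by
    intro z hz
    have h1 : (z - b) / (z - a) = 1 + (-((b - a) / (z - a))) := by
      have := hne z hz
      field_simp
      ring
    rw [h1]
    apply Complex.mem_slitPlane_of_norm_lt_one
    rw [norm_neg, norm_div, div_lt_one (norm_pos_iff.2 (hne z hz))]
    simpa [dist_eq_norm] using hab z hz
  refine ⟨fun z => g z + Complex.log ((z - b) / (z - a)), hg.add (ContinuousOn.clog ?_ hs), ?_⟩
  · exact (continuousOn_id.sub continuousOn_const).div (continuousOn_id.sub continuousOn_const) hne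
  · intro z hz
    rw [Complex.exp_add, hgT z hz, Complex.exp_log (Complex.slitPlane_ne_zero (hs z hz)),
      mul_div_cancel₀ _ (hne z hz)]

/-- A logarithm exists on a full compact set not containing its singularity. -/
theorem IsFull.hasLogBranch {T : Set ℂ} (hT : IsFull T) (hc : IsCompact T) {a : ℂ} (ha : a ∉ T) :
    HasLogBranch T a := by
  by_contra hna
  have key : ∀ x ∉ T, ∃ ε > 0, ∀ y ∈ Metric.ball x ε, y ∉ T ∧ (HasLogBranch T x ↔ HasLogBranch T y) := by
    intro x hx
    obtain ⟨ε, hε, hb⟩ := Metric.isOpen_iff.1 hc.isClosed.isOpen_compl x hx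
    refine ⟨ε / 2, by positivity, fun y hy => ⟨hb (Metric.ball_subset_ball (by linarith) hy), ?_⟩⟩
    have hfar : ∀ z ∈ T, ε ≤ dist z x := fun z hz => by
      by_contra hlt
      exact hb (Metric.mem_ball.2 (not_le.1 hlt)) hz
    rw [Metric.mem_ball] at hy
    refine ⟨fun h => h.of_dist_lt fun z hz => by linarith [hfar z hz], fun h =>
      h.of_dist_lt fun z hz => ?_⟩
    have h1 := hfar z hz
    have h2 := dist_triangle z y x
    rw [dist_comm x y]
    linarith
  -- By `key` the bad parameters form an open set with frontier in `T`. It is bounded, since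
  -- $\log(1-z/x)$ is available for large $x$. Fullness would then put `a` in `T`.
  let D : Set ℂ := {x | x ∉ T ∧ ¬ HasLogBranch T x}
  obtain ⟨R, hR⟩ := hc.isBounded.subset_ball 0
  have hD : IsOpen D := by
    rw [Metric.isOpen_iff]
    rintro x ⟨hx, hxl⟩
    obtain ⟨ε, hε, hy⟩ := key x hx
    exact ⟨ε, hε, fun y hyb => ⟨(hy y hyb).1, fun h => hxl ((hy y hyb).2.2 h)⟩⟩
  have hb : Bornology.IsBounded D := by
    refine (Metric.isBounded_closedBall (x := (0 : ℂ)) (r := R)).subset ?_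
    rintro x ⟨hx, hxl⟩
    by_contra hxR
    rw [Metric.mem_closedBall, dist_zero_right, not_le] at hxR
    refine hxl ?_
    have hs : ∀ z ∈ T, 1 - z / x ∈ Complex.slitPlane := by
      intro z hz
      have hz' := hR hz
      rw [Metric.mem_ball, dist_zero_right] at hz'
      rw [sub_eq_add_neg]
      apply Complex.mem_slitPlane_of_norm_lt_one
      rw [norm_neg, norm_div, div_lt_one (by linarith [norm_nonneg z])]
      linarith
    by_cases hx0 : x = 0
    · have hTe : ∀ z ∈ T, False := fun z hz => by
        have hz' := hR hz
        rw [Metric.mem_ball, dist_zero_right] at hz'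
        rw [hx0, norm_zero] at hxR
        linarith [norm_nonneg z]
      exact ⟨0, continuousOn_const, fun z hz => (hTe z hz).elim⟩
    · refine ⟨fun z => Complex.log (-x) + Complex.log (1 - z / x),
        continuousOn_const.add (ContinuousOn.clog (by fun_prop) hs), fun z hz => ?_⟩
      rw [Complex.exp_add, Complex.exp_log (neg_ne_zero.2 hx0),
        Complex.exp_log (Complex.slitPlane_ne_zero (hs z hz))]
      field_simp
      ring
  refine (hT D hD hb ?_ (show a ∈ D from ⟨ha, hna⟩) |> ha)
  intro y hy
  by_contra hyT
  obtain ⟨ε, hε, hyb⟩ := key y hyT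
  obtain ⟨u, hu1, hu2⟩ := mem_closure_iff.1 hy.1 _ Metric.isOpen_ball (Metric.mem_ball_self hε)
  refine (isOpen_disjoint_frontier hD).notMem_of_mem_left (show y ∈ D from
    ⟨hyT, fun h => hu2.2 ((hyb u hu1).2.1 h)⟩) hy

/-- A full continuum that is symmetric with respect to `0` contains `0`. -/
theorem IsFull.zero_mem_of_neg_mem {T : Set ℂ} (hT : IsFull T) (hc : IsCompact T)
    (hp : IsPreconnected T) (hne : T.Nonempty) (hsymm : ∀ z ∈ T, -z ∈ T) : (0 : ℂ) ∈ T := by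
  by_contra h0
  obtain ⟨g, hg, hgT⟩ := hT.hasLogBranch hc h0
  simp only [sub_zero] at hgT
  -- A continuous square root of $(-z)/z=-1$ on `T`, hence constant. But `e z * e (-z) = 1` would
  -- then give $-1=1$.
  let e : ℂ → ℂ := fun z => Complex.exp ((g (-z) - g z) / 2)
  have he : ContinuousOn e T := by
    refine Complex.continuous_exp.comp_continuousOn (ContinuousOn.div_const (ContinuousOn.sub ?_ hg) _)
    exact hg.comp continuousOn_neg hsymm
  have hsq : ∀ z ∈ T, e z ^ 2 = -1 := by
    intro z hz
    have hz0 : z ≠ 0 := fun h => h0 (h ▸ hz)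
    simp only [e]
    rw [← Complex.exp_nat_mul]
    push_cast
    rw [mul_div_cancel₀ _ two_ne_zero, Complex.exp_sub, hgT z hz, hgT _ (hsymm z hz)]
    field_simp
  have hmaps : MapsTo e T {Complex.I, -Complex.I} := by
    intro z hz
    have h1 := hsq z hz
    rw [← Complex.I_sq, sq_eq_sq_iff_eq_or_eq_neg] at h1
    exact h1
  have hfin : ({Complex.I, -Complex.I} : Set ℂ).Finite := by simp
  obtain ⟨z, hz⟩ := hne
  have h1 := hp.constant_of_mapsTo hfin.isDiscrete he hmaps hz (hsymm z hz)
  have h2 : e z * e (-z) = 1 := by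
    simp only [e]
    rw [← Complex.exp_add, neg_neg, ← Complex.exp_zero]
    congr 1
    ring
  rw [← h1, ← sq, hsq z hz] at h2
  norm_num at h2

theorem isPreconnected_compl_singleton_complex (a : ℂ) : IsPreconnected ({a}ᶜ : Set ℂ) :=
  (isConnected_compl_singleton_of_one_lt_rank (by simp [Complex.rank_real_complex]) a).isPreconnected

/-- The punctured plane is connected, so a nonempty `D` would contain all of it and be unbounded. -/
theorem eq_empty_of_frontier_subset_singleton {D : Set ℂ} (hD : IsOpen D)
    (hb : Bornology.IsBounded D) {a : ℂ} (hfr : frontier D ⊆ {a}) : D = ∅ := by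
  by_contra hne
  obtain ⟨d, hd⟩ := nonempty_iff_ne_empty.2 hne
  have hmeet : ({a}ᶜ ∩ D).Nonempty := by
    rw [inter_comm, ← sdiff_eq]
    exact ((hD.mem_nhds hd |> infinite_of_mem_nhds d).sdiff (finite_singleton a)).nonempty
  have hsub := (isPreconnected_compl_singleton_complex a).subset_of_disjoint_frontier hD hmeet
    (disjoint_compl_left_iff_subset.2 hfr)
  refine NormedSpace.unbounded_univ ℂ ℂ ((hb.union (Bornology.isBounded_singleton (x := a))).subset ?_)
  intro x _
  by_cases hx : x = a
  · exact Or.inr hx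
  · exact Or.inl (hsub hx)

/-! ### Escape to infinity under a quadratic polynomial -/

section QuadPoly

variable (c : ℂ)

theorem continuous_quadPoly : Continuous (quadPoly c) := by
  unfold quadPoly; fun_prop

theorem quadPoly_neg (z : ℂ) : quadPoly c (-z) = quadPoly c z := by
  simp [quadPoly]

theorem quadPoly_eq_iff {z w : ℂ} : quadPoly c z = quadPoly c w ↔ z = w ∨ z = -w := by
  simp [quadPoly, sq_eq_sq_iff_eq_or_eq_neg]

theorem exists_quadPoly_eq (w : ℂ) : ∃ z, quadPoly c z = w := by
  obtain ⟨z, hz⟩ := IsAlgClosed.exists_pow_nat_eq (w - c) two_pos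
  exact ⟨z, by rw [quadPoly, hz, sub_add_cancel]⟩

theorem isOpenMap_quadPoly : IsOpenMap (quadPoly c) := by
  have ha : AnalyticOnNhd ℂ (quadPoly c) univ := by
    have : Differentiable ℂ (quadPoly c) := by unfold quadPoly; fun_prop
    exact fun z _ => this.analyticAt z
  rcases ha.is_constant_or_isOpen isPreconnected_univ with ⟨w, hw⟩ | h
  · have h0 := hw 0 (mem_univ _)
    have h1 := hw 1 (mem_univ _)
    rw [← h1, quadPoly_eq_iff] at h0
    simp at h0
  · exact fun s hs => h s (subset_univ _) hs

theorem continuous_quadPoly_iterate (n : ℕ) : Continuous (quadPoly c)^[n] :=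
  (continuous_quadPoly c).iterate n

theorem isOpenMap_quadPoly_iterate (n : ℕ) : IsOpenMap (quadPoly c)^[n] := by
  induction n with
  | zero => exact IsOpenMap.id
  | succ n ih => exact ih.comp (isOpenMap_quadPoly c)

theorem le_norm_quadPoly {z : ℂ} (hz : 2 + ‖c‖ ≤ ‖z‖) : 2 * ‖z‖ ≤ ‖quadPoly c z‖ := by
  have h1 : ‖z‖ ^ 2 - ‖c‖ ≤ ‖quadPoly c z‖ := by
    have := norm_sub_le (quadPoly c z) c
    rw [quadPoly, add_sub_cancel_right, norm_pow] at this
    rw [quadPoly]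
    linarith
  nlinarith [norm_nonneg c, norm_nonneg z]

theorem le_norm_quadPoly_iterate {z : ℂ} (hz : 2 + ‖c‖ ≤ ‖z‖) (n : ℕ) :
    2 ^ n * ‖z‖ ≤ ‖(quadPoly c)^[n] z‖ := by
  induction n with
  | zero => simp
  | succ n ih =>
    rw [Function.iterate_succ_apply']
    have h1 : ‖z‖ ≤ 2 ^ n * ‖z‖ := le_mul_of_one_le_left (norm_nonneg _) (one_le_pow₀ one_le_two)
    have := le_norm_quadPoly c (hz.trans (h1.trans ih))
    rw [pow_succ]
    linarith

theorem mem_basinInfty_quadPoly {z : ℂ} : quadPoly c z ∈ basinInfty c ↔ z ∈ basinInfty c := by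
  simp only [basinInfty, mem_ofPred_eq, ← Function.iterate_succ_apply]
  exact tendsto_add_atTop_iff_nat (f := fun n => (quadPoly c)^[n] z) 1

theorem mem_basinInfty_quadPoly_iterate {z : ℂ} (n : ℕ) :
    (quadPoly c)^[n] z ∈ basinInfty c ↔ z ∈ basinInfty c := by
  induction n with
  | zero => rfl
  | succ n ih => rw [Function.iterate_succ_apply', mem_basinInfty_quadPoly, ih]

theorem mem_basinInfty_of_le_norm {z : ℂ} (hz : 2 + ‖c‖ ≤ ‖z‖) : z ∈ basinInfty c := by
  show Tendsto _ _ _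
  rw [← Metric.cobounded_eq_cocompact]
  refine tendsto_norm_atTop_iff_cobounded.1 (tendsto_atTop_mono (le_norm_quadPoly_iterate c hz) ?_)
  exact (tendsto_pow_atTop_atTop_of_one_lt one_lt_two).atTop_mul_const
    (by linarith [norm_nonneg c])

theorem mem_basinInfty_iff {z : ℂ} :
    z ∈ basinInfty c ↔ ∃ n, 2 + ‖c‖ < ‖(quadPoly c)^[n] z‖ := by
  constructor
  · intro h
    exact ((tendsto_norm_cocompact_atTop.comp h).eventually_gt_atTop _).exists
  · rintro ⟨n, hn⟩
    exact (mem_basinInfty_quadPoly_iterate c n).1 (mem_basinInfty_of_le_norm c hn.le)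

theorem isOpen_basinInfty : IsOpen (basinInfty c) := by
  have : basinInfty c = ⋃ n, {z | 2 + ‖c‖ < ‖(quadPoly c)^[n] z‖} := by
    ext z; simp [mem_basinInfty_iff]
  rw [this]
  exact isOpen_iUnion fun n => isOpen_lt continuous_const (continuous_quadPoly_iterate c n).norm

theorem exists_lt_norm_iterate_of_isCompact {A : Set ℂ} (hA : IsCompact A)
    (hAb : A ⊆ basinInfty c) (S : ℝ) : ∃ m₀, ∀ m ≥ m₀, ∀ z ∈ A, S < ‖(quadPoly c)^[m] z‖ := by
  obtain ⟨t, ht⟩ := hA.elim_finite_subcover (fun n => {z | 2 + ‖c‖ < ‖(quadPoly c)^[n] z‖})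
    (fun n => isOpen_lt continuous_const (continuous_quadPoly_iterate c n).norm)
    (fun z hz => mem_iUnion.2 ((mem_basinInfty_iff c).1 (hAb hz)))
  obtain ⟨j, hj⟩ := pow_unbounded_of_one_lt S (one_lt_two (α := ℝ))
  refine ⟨t.sup id + j, fun m hm z hz => ?_⟩
  obtain ⟨n, hn, hzn⟩ := mem_iUnion₂.1 (ht hz)
  have hnt : n ≤ t.sup id := Finset.le_sup (f := id) hn
  obtain ⟨i, rfl⟩ : ∃ i, m = (j + i) + n := ⟨m - j - n, by omega⟩
  simp only [mem_ofPred_eq] at hzn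
  rw [Function.iterate_add_apply]
  have h1 := le_norm_quadPoly_iterate c hzn.le (j + i)
  have h2 : (2 : ℝ) ^ j ≤ 2 ^ (j + i) := pow_le_pow_right₀ one_le_two (Nat.le_add_right _ _)
  have h3 : (1 : ℝ) ≤ ‖(quadPoly c)^[n] z‖ := by linarith [norm_nonneg c]
  nlinarith [pow_pos (zero_lt_two (α := ℝ)) (j + i)]

end QuadPoly

/-! ### The Böttcher function and its level sets -/

/-- The inverse of the Böttcher function. -/
noncomputable def bottcherInv (c : ℂ) (B : ℂ → ℂ) : ℂ → ℂ :=
  Function.invFunOn B (basinInfty c)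

namespace IsBottcher

variable {c : ℂ} {B : ℂ → ℂ}

theorem one_lt_norm (hB : IsBottcher c B) {z : ℂ} (hz : z ∈ basinInfty c) : 1 < ‖B z‖ :=
  hB.bij.mapsTo hz

theorem norm_quadPoly (hB : IsBottcher c B) {z : ℂ} (hz : z ∈ basinInfty c) :
    ‖B (quadPoly c z)‖ = ‖B z‖ ^ 2 := by
  rw [hB.conj z hz, norm_pow]

theorem inv_mem (hB : IsBottcher c B) {w : ℂ} (hw : 1 < ‖w‖) : bottcherInv c B w ∈ basinInfty c :=
  Function.invFunOn_mem (hB.bij.surjOn hw)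

theorem apply_inv (hB : IsBottcher c B) {w : ℂ} (hw : 1 < ‖w‖) : B (bottcherInv c B w) = w :=
  hB.bij.invOn_invFunOn.2 hw

theorem inv_apply (hB : IsBottcher c B) {z : ℂ} (hz : z ∈ basinInfty c) :
    bottcherInv c B (B z) = z :=
  hB.bij.invOn_invFunOn.1 hz

theorem continuousAt (hB : IsBottcher c B) {z : ℂ} (hz : z ∈ basinInfty c) : ContinuousAt B z :=
  hB.holo.continuousOn.continuousAt ((isOpen_basinInfty c).mem_nhds hz)

theorem nhds_le_map (hB : IsBottcher c B) {z : ℂ} (hz : z ∈ basinInfty c) :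
    𝓝 (B z) ≤ map B (𝓝 z) := by
  have hn : basinInfty c ∈ 𝓝 z := (isOpen_basinInfty c).mem_nhds hz
  refine (hB.holo.analyticAt hn).eventually_constant_or_nhds_le_map_nhds.resolve_left fun h => ?_
  have h1 : ∀ᶠ y in 𝓝 z, y = z := by
    filter_upwards [h, hn] with y hy hyb
    exact hB.bij.injOn hyb hz hy
  have h2 : ({z} : Set ℂ) ∈ 𝓝 z := h1
  exact (infinite_of_mem_nhds z h2) (finite_singleton z)

theorem continuousAt_inv (hB : IsBottcher c B) {w : ℂ} (hw : 1 < ‖w‖) :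
    ContinuousAt (bottcherInv c B) w := by
  have hz := hB.inv_mem hw
  have h1 := hB.nhds_le_map hz
  rw [hB.apply_inv hw] at h1
  refine Tendsto.mono_left ?_ h1
  rw [tendsto_map'_iff]
  refine Tendsto.congr' ?_ tendsto_id
  filter_upwards [(isOpen_basinInfty c).mem_nhds hz] with y hy
  exact (hB.inv_apply hy).symm

/-- If $0$ escaped, `B` would be odd near $0$: the point with Böttcher value $-B(z)$ has the same
image as $z$, so it is $-z$. Continuity would give $B(0)=0$, against $|B|>1$. -/
theorem zero_notMem (hB : IsBottcher c B) : (0 : ℂ) ∉ basinInfty c := by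
  intro h0
  have hn : basinInfty c ∈ 𝓝 (0 : ℂ) := (isOpen_basinInfty c).mem_nhds h0
  have hneg : ∀ z ∈ basinInfty c, z ≠ 0 → B (-z) = -B z := by
    intro z hz hz0
    have h1 : 1 < ‖-B z‖ := by rw [norm_neg]; exact hB.one_lt_norm hz
    set y := bottcherInv c B (-B z)
    have hy : y ∈ basinInfty c := hB.inv_mem h1
    have hBy : B y = -B z := hB.apply_inv h1
    have hP : quadPoly c y = quadPoly c z := by
      refine hB.bij.injOn ((mem_basinInfty_quadPoly c).2 hy) ((mem_basinInfty_quadPoly c).2 hz) ?_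
      rw [hB.conj y hy, hB.conj z hz, hBy, neg_sq]
    rcases (quadPoly_eq_iff c).1 hP with h | h
    · rw [h] at hBy
      have : B z = 0 := self_eq_neg.1 hBy
      have h2 := hB.one_lt_norm hz
      rw [this, norm_zero] at h2
      linarith
    · rw [← h, hBy]
  have hc := hB.continuousAt h0
  have ht1 : Tendsto (fun z => B (-z)) (𝓝[≠] 0) (𝓝 (B 0)) := by
    have h3 : Tendsto (fun z : ℂ => -z) (𝓝[≠] 0) (𝓝 0) := by
      have := (continuous_neg (G := ℂ)).tendsto 0
      rw [neg_zero] at this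
      exact this.mono_left nhdsWithin_le_nhds
    exact hc.tendsto.comp h3
  have ht2 : Tendsto (fun z => B (-z)) (𝓝[≠] 0) (𝓝 (-B 0)) := by
    refine Tendsto.congr' ?_ (hc.tendsto.neg.mono_left nhdsWithin_le_nhds)
    filter_upwards [nhdsWithin_le_nhds hn, self_mem_nhdsWithin] with z hz hz0
    exact (hneg z hz hz0).symm
  have h4 : B 0 = 0 := self_eq_neg.1 (tendsto_nhds_unique ht1 ht2)
  have h2 := hB.one_lt_norm h0
  rw [h4, norm_zero] at h2
  linarith

theorem norm_quadPoly_iterate (hB : IsBottcher c B) {z : ℂ} (hz : z ∈ basinInfty c) (n : ℕ) :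
    ‖B ((quadPoly c)^[n] z)‖ = ‖B z‖ ^ (2 ^ n) := by
  induction n with
  | zero => simp
  | succ n ih =>
    rw [Function.iterate_succ_apply',
      hB.norm_quadPoly ((mem_basinInfty_quadPoly_iterate c n).2 hz), ih, ← pow_mul, ← pow_succ]

/-- The set of points at level at least `s > 1` is closed in the plane. -/
theorem isClosed_superlevel (hB : IsBottcher c B) {s : ℝ} (hs : 1 < s) :
    IsClosed {z | z ∈ basinInfty c ∧ s ≤ ‖B z‖} := by
  -- The preimage `A` of this closed annulus is a compact fundamental domain: its forward images
  -- fill the superlevel set. They escape uniformly, so the family is locally finite and its union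
  -- closed.
  set N : Set ℂ := {w | s ≤ ‖w‖ ∧ ‖w‖ ≤ s ^ 2}
  have hN : IsCompact N := by
    refine (isCompact_closedBall (0 : ℂ) (s ^ 2)).of_isClosed_subset
      ((isClosed_le continuous_const continuous_norm).inter
        (isClosed_le continuous_norm continuous_const)) ?_
    rintro w ⟨-, hw⟩
    simpa using hw
  set A : Set ℂ := bottcherInv c B '' N
  have hA : IsCompact A := hN.image_of_continuousOn fun w hw =>
    (hB.continuousAt_inv (hs.trans_le hw.1)).continuousWithinAt
  have hAb : A ⊆ basinInfty c := by
    rintro _ ⟨w, hw, rfl⟩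
    exact hB.inv_mem (hs.trans_le hw.1)
  have hmemA : ∀ z ∈ basinInfty c, s ≤ ‖B z‖ → ‖B z‖ ≤ s ^ 2 → z ∈ A := fun z hz h1 h2 =>
    ⟨B z, ⟨h1, h2⟩, hB.inv_apply hz⟩
  have hcover : ∀ m : ℕ, ∀ z ∈ basinInfty c, s ≤ ‖B z‖ → ‖B z‖ ≤ s ^ (2 ^ (m + 1)) →
      ∃ j, z ∈ (quadPoly c)^[j] '' A := by
    intro m
    induction m with
    | zero => exact fun z hz h1 h2 => ⟨0, by simpa using hmemA z hz h1 (by simpa using h2)⟩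
    | succ m ih =>
      intro z hz h1 h2
      by_cases hle : ‖B z‖ ≤ s ^ 2
      · exact ⟨0, by simpa using hmemA z hz h1 hle⟩
      · obtain ⟨y, rfl⟩ := exists_quadPoly_eq c z
        have hy := (mem_basinInfty_quadPoly c).1 hz
        rw [hB.norm_quadPoly hy] at hle h2
        have h3 : s ≤ ‖B y‖ := (lt_of_pow_lt_pow_left₀ 2 (norm_nonneg _) (not_le.1 hle)).le
        have h4 : ‖B y‖ ≤ s ^ (2 ^ (m + 1)) := by
          refine le_of_pow_le_pow_left₀ two_ne_zero (by positivity) (h2.trans_eq ?_)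
          rw [← pow_mul, ← pow_succ]
        obtain ⟨j, x, hx, hxy⟩ := ih y hy h3 h4
        exact ⟨j + 1, x, hx, by rw [Function.iterate_succ_apply', hxy]⟩
  have heq : {z | z ∈ basinInfty c ∧ s ≤ ‖B z‖} = ⋃ j, (quadPoly c)^[j] '' A := by
    ext z
    rw [mem_iUnion]
    constructor
    · rintro ⟨hz, hsz⟩
      obtain ⟨m, hm⟩ := pow_unbounded_of_one_lt ‖B z‖ hs
      refine hcover m z hz hsz (hm.le.trans (pow_le_pow_right₀ hs.le ?_))
      exact (Nat.lt_two_pow_self).le.trans (Nat.pow_le_pow_right two_pos (Nat.le_succ m))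
    · rintro ⟨j, x, hx, rfl⟩
      have hxb := hAb hx
      refine ⟨(mem_basinInfty_quadPoly_iterate c j).2 hxb, ?_⟩
      rw [hB.norm_quadPoly_iterate hxb]
      obtain ⟨w, hw, rfl⟩ := hx
      rw [hB.apply_inv (hs.trans_le hw.1)]
      exact hw.1.trans (le_self_pow₀ (hs.le.trans hw.1) (by positivity))
  rw [heq]
  refine LocallyFinite.isClosed_iUnion (fun x => ⟨Metric.ball x 1, Metric.ball_mem_nhds x one_pos, ?_⟩)
    fun j => (hA.image (continuous_quadPoly_iterate c j)).isClosed
  obtain ⟨m₀, hm₀⟩ := exists_lt_norm_iterate_of_isCompact c hA hAb (‖x‖ + 1)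
  refine (finite_lt_nat m₀).subset ?_
  rintro j ⟨_, ⟨y, hy, rfl⟩, hyb⟩
  by_contra hj
  have h1 := hm₀ j (not_lt.1 hj) y hy
  rw [Metric.mem_ball, dist_eq_norm] at hyb
  have h2 := norm_sub_norm_le ((quadPoly c)^[j] y) x
  linarith

theorem isOpen_openLevelRegion (hB : IsBottcher c B) {r : ℝ} (hr : 1 < r) :
    IsOpen (openLevelRegion c B r) := by
  have : openLevelRegion c B r = {z | z ∈ basinInfty c ∧ r ≤ ‖B z‖}ᶜ := by
    ext z; simp [openLevelRegion]
  rw [this]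
  exact (hB.isClosed_superlevel hr).isOpen_compl

theorem isCompact_closedLevelRegion (hB : IsBottcher c B) (r : ℝ) :
    IsCompact (closedLevelRegion c B r) := by
  have hc : closedLevelRegion c B r = {z | z ∈ basinInfty c ∧ r < ‖B z‖}ᶜ := by
    ext z; simp [closedLevelRegion]
  have hcl : IsClosed (closedLevelRegion c B r) := by
    rw [hc, isClosed_compl_iff]
    exact (hB.holo.continuousOn.norm).isOpen_inter_preimage (isOpen_basinInfty c) isOpen_Ioi
  refine Metric.isCompact_of_isClosed_isBounded hcl ?_
  -- Near infinity $|B(z)|>|z|/2$, so $|z|\ge 2r+1$ excludes level at most $r$.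
  have h1 := hB.asymp.norm.eventually (lt_mem_nhds (show (1 / 2 : ℝ) < ‖(1 : ℂ)‖ by norm_num))
  rw [← Metric.cobounded_eq_cocompact] at h1
  have h2 := (tendsto_norm_cobounded_atTop (E := ℂ)).eventually_ge_atTop (max (2 + ‖c‖) (2 * r + 1))
  have h3 : ∀ᶠ z in Bornology.cobounded ℂ, z ∈ (closedLevelRegion c B r)ᶜ := by
    filter_upwards [h1, h2] with z hz1 hz2 hz
    have h4 := hz (mem_basinInfty_of_le_norm c ((le_max_left _ _).trans hz2))
    have h5 : 2 * r + 1 ≤ ‖z‖ := (le_max_right _ _).trans hz2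
    have h6 : 0 < ‖z‖ := by
      linarith [norm_nonneg c, (le_max_left _ _).trans hz2]
    rw [norm_div, lt_div_iff₀ h6] at hz1
    linarith
  exact Bornology.isBounded_def.2 h3

end IsBottcher

/-! ### External rays and the cut region -/

/-- The domain bounded by the equipotential of level `r` of `z ↦ z² + c`, cut along the external
rays landing at `a` and along `a` itself. -/
def polyCutRegion (c : ℂ) (B : ℂ → ℂ) (a : ℂ) (r : ℝ) : Set ℂ :=
  {z | z ∈ openLevelRegion c B r ∧ z ≠ a ∧ ∀ t : ℝ, RayLandsAt c B t a → z ∉ externalRay c B t}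

theorem externalRay_fract (c : ℂ) (B : ℂ → ℂ) (t : ℝ) :
    externalRay c B (Int.fract t) = externalRay c B t := by
  have : Complex.exp (2 * Real.pi * (Int.fract t : ℝ) * Complex.I) =
      Complex.exp (2 * Real.pi * t * Complex.I) := by
    rw [Complex.exp_eq_exp_iff_exists_int]
    refine ⟨-⌊t⌋, ?_⟩
    rw [← Int.self_sub_floor]
    push_cast
    ring
  unfold externalRay
  rw [this]

theorem rayLandsAt_fract {c : ℂ} {B : ℂ → ℂ} {t : ℝ} {a : ℂ} :
    RayLandsAt c B (Int.fract t) a ↔ RayLandsAt c B t a := by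
  unfold RayLandsAt
  rw [externalRay_fract]

theorem norm_exp_turn (t : ℝ) : ‖Complex.exp (2 * Real.pi * t * Complex.I)‖ = 1 := by
  rw [show (2 * Real.pi * t * Complex.I : ℂ) = ((2 * Real.pi * t : ℝ) : ℂ) * Complex.I by
    push_cast; ring]
  exact Complex.norm_exp_ofReal_mul_I _

theorem eq_norm_mul_of_mem_externalRay {c : ℂ} {B : ℂ → ℂ} {t : ℝ} {z : ℂ}
    (hz : z ∈ externalRay c B t) :
    B z = (‖B z‖ : ℂ) * Complex.exp (2 * Real.pi * t * Complex.I) := by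
  obtain ⟨-, ρ, hρ, h⟩ := hz
  have : ‖B z‖ = ρ := by
    rw [h, norm_mul, norm_exp_turn, mul_one, Complex.norm_real, Real.norm_of_nonneg (by linarith)]
  rw [this, h]

namespace IsBottcher

variable {c : ℂ} {B : ℂ → ℂ} {a : ℂ} {r : ℝ}

theorem mem_externalRay (hB : IsBottcher c B) {t : ℝ} {z : ℂ} (hz : z ∈ basinInfty c)
    (h : B z = (‖B z‖ : ℂ) * Complex.exp (2 * Real.pi * t * Complex.I)) :
    z ∈ externalRay c B t :=
  ⟨hz, ‖B z‖, hB.one_lt_norm hz, h⟩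

/-- Landing forces the ray points near a limit point other than `a` to have level at least
$1+\delta$. Superlevel sets are closed, so the limit lies in the basin, where continuity of `B`
preserves the angle. -/
theorem isClosed_insert_externalRay (hB : IsBottcher c B) {t : ℝ} (ht : RayLandsAt c B t a) :
    IsClosed (insert a (externalRay c B t)) := by
  refine isClosed_of_closure_subset fun x hx => ?_
  rw [insert_eq, closure_union, closure_singleton] at hx
  rcases hx with hx | hx
  · exact Or.inl hx
  by_cases hxa : x = a
  · exact Or.inl hxa
  refine Or.inr ?_
  have hε : 0 < dist x a / 2 := by have := dist_pos.2 hxa; linarith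
  obtain ⟨δ, hδ, hlev⟩ := ht _ hε
  have hxb : x ∈ {z | z ∈ basinInfty c ∧ 1 + δ ≤ ‖B z‖} := by
    rw [← (hB.isClosed_superlevel (show 1 < 1 + δ by linarith)).closure_eq]
    have h1 : x ∈ closure (Metric.ball x (dist x a / 2) ∩ externalRay c B t) :=
      Metric.isOpen_ball.inter_closure ⟨Metric.mem_ball_self hε, hx⟩
    refine closure_mono ?_ h1
    rintro y ⟨hyb, hy⟩
    refine ⟨hy.1, ?_⟩
    by_contra hlt
    have h2 := hlev y hy (not_le.1 hlt)
    rw [Metric.mem_ball, dist_comm] at hyb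
    linarith [dist_triangle x y a]
  have hcl : IsClosed {w : ℂ | w = (‖w‖ : ℂ) * Complex.exp (2 * Real.pi * t * Complex.I)} :=
    isClosed_eq continuous_id (by fun_prop)
  refine hB.mem_externalRay hxb.1 ?_
  have hmaps : MapsTo B (externalRay c B t)
      {w : ℂ | w = (‖w‖ : ℂ) * Complex.exp (2 * Real.pi * t * Complex.I)} :=
    fun y hy => eq_norm_mul_of_mem_externalRay hy
  have h3 := (hB.continuousAt hxb.1).continuousWithinAt.mem_closure hx hmaps
  rwa [hcl.closure_eq] at h3

theorem quadPoly_mem_externalRay (hB : IsBottcher c B) {t : ℝ} {z : ℂ}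
    (hz : z ∈ externalRay c B t) : quadPoly c z ∈ externalRay c B (2 * t) := by
  obtain ⟨hzb, ρ, hρ, h⟩ := hz
  refine ⟨(mem_basinInfty_quadPoly c).2 hzb, ρ ^ 2, by nlinarith, ?_⟩
  rw [hB.conj z hzb, h, mul_pow, ← Complex.exp_nat_mul]
  push_cast
  congr 2
  ring

theorem exists_mem_externalRay_quadPoly_eq (hB : IsBottcher c B) {t : ℝ} {y : ℂ}
    (hy : y ∈ externalRay c B (2 * t)) :
    ∃ z ∈ externalRay c B t, quadPoly c z = y ∧ ‖B z‖ ^ 2 = ‖B y‖ := by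
  obtain ⟨hyb, ρ, hρ, h⟩ := hy
  set w : ℂ := (√ρ : ℝ) * Complex.exp (2 * Real.pi * t * Complex.I)
  have hs : 1 < √ρ := by rw [Real.lt_sqrt zero_le_one]; simpa using hρ
  have hnw : ‖w‖ = √ρ := by
    simp only [w]
    rw [norm_mul, norm_exp_turn, mul_one, Complex.norm_real, Real.norm_of_nonneg (by linarith)]
  have hw : 1 < ‖w‖ := by rwa [hnw]
  have hz := hB.inv_mem hw
  have hP : quadPoly c (bottcherInv c B w) = y := by
    refine hB.bij.injOn ((mem_basinInfty_quadPoly c).2 hz) hyb ?_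
    rw [hB.conj _ hz, hB.apply_inv hw, h]
    simp only [w]
    rw [mul_pow, ← Complex.exp_nat_mul, ← Complex.ofReal_pow, Real.sq_sqrt (by linarith)]
    push_cast
    congr 2
    ring
  refine ⟨_, ⟨hz, √ρ, hs, hB.apply_inv hw⟩, hP, ?_⟩
  rw [← hP, hB.norm_quadPoly hz]

theorem rayLandsAt_two_mul (hB : IsBottcher c B) (ha : quadPoly c a = a) {t : ℝ}
    (ht : RayLandsAt c B t a) : RayLandsAt c B (2 * t) a := by
  intro ε hε
  obtain ⟨η, hη, hcont⟩ := Metric.continuousAt_iff.1 (continuous_quadPoly c).continuousAt ε hε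
  obtain ⟨δ, hδ, hlev⟩ := ht η hη
  refine ⟨δ, hδ, fun y hy hyl => ?_⟩
  obtain ⟨z, hz, rfl, hzy⟩ := hB.exists_mem_externalRay_quadPoly_eq hy
  have h1 : ‖B z‖ < 1 + δ := by
    have := hB.one_lt_norm hz.1
    nlinarith
  have := hcont (hlev z hz h1)
  rwa [ha] at this

theorem mem_openLevelRegion_of_quadPoly_mem (hB : IsBottcher c B) {z : ℂ}
    (hz : quadPoly c z ∈ openLevelRegion c B r) : z ∈ openLevelRegion c B r := by
  intro hzb
  have h1 := hz ((mem_basinInfty_quadPoly c).2 hzb)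
  rw [hB.norm_quadPoly hzb] at h1
  have := hB.one_lt_norm hzb
  nlinarith

theorem mem_closedLevelRegion_of_quadPoly_mem (hB : IsBottcher c B) {z : ℂ}
    (hz : quadPoly c z ∈ closedLevelRegion c B r) : z ∈ closedLevelRegion c B r := by
  intro hzb
  have h1 := hz ((mem_basinInfty_quadPoly c).2 hzb)
  rw [hB.norm_quadPoly hzb] at h1
  have := hB.one_lt_norm hzb
  nlinarith

/-- The cuts are forward invariant and levels drop under preimages. This Markov property is what
makes puzzle pieces nested. -/
theorem mem_polyCutRegion_of_quadPoly_mem (hB : IsBottcher c B) (ha : quadPoly c a = a)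
    {z : ℂ} (hz : quadPoly c z ∈ polyCutRegion c B a r) :
    z ∈ polyCutRegion c B a r := by
  refine ⟨hB.mem_openLevelRegion_of_quadPoly_mem hz.1, ?_, fun t ht hzt =>
    hz.2.2 (2 * t) (hB.rayLandsAt_two_mul ha ht) (hB.quadPoly_mem_externalRay hzt)⟩
  rintro rfl
  exact hz.2.1 ha

theorem isOpen_polyCutRegion (hB : IsBottcher c B) (hr : 1 < r)
    (hfin : {t | t ∈ Ico (0 : ℝ) 1 ∧ RayLandsAt c B t a}.Finite) :
    IsOpen (polyCutRegion c B a r) := by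
  have heq : polyCutRegion c B a r = openLevelRegion c B r ∩ {a}ᶜ ∩
      ⋂ t ∈ {t | t ∈ Ico (0 : ℝ) 1 ∧ RayLandsAt c B t a}, (insert a (externalRay c B t))ᶜ := by
    ext z
    simp only [polyCutRegion, mem_inter_iff, mem_iInter, mem_compl_iff, mem_insert_iff,
      mem_singleton_iff, not_or, mem_ofPred_eq, and_assoc]
    refine and_congr_right fun _ => and_congr_right fun hza => ?_
    constructor
    · exact fun h t ht => ⟨hza, h t ht.2⟩
    · intro h t ht
      rw [← externalRay_fract]
      exact (h _ ⟨⟨Int.fract_nonneg t, Int.fract_lt_one t⟩, rayLandsAt_fract.2 ht⟩).2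
  rw [heq]
  refine ((hB.isOpen_openLevelRegion hr).inter isOpen_compl_singleton).inter
    (hfin.isOpen_biInter fun t ht => ?_)
  exact (hB.isClosed_insert_externalRay ht.2).isOpen_compl

end IsBottcher

theorem mem_polyCutRegion_of_notMem_basinInfty {c : ℂ} {B : ℂ → ℂ} {a : ℂ} {r : ℝ} {z : ℂ}
    (hz : z ∉ basinInfty c) (hza : z ≠ a) : z ∈ polyCutRegion c B a r :=
  ⟨fun h => (hz h).elim, hza, fun _ _ h => hz h.1⟩

/-! ### Motion along external rays -/

/-- The point of level `σ` on the external ray through `z`. -/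
noncomputable def radialPoint (c : ℂ) (B : ℂ → ℂ) (σ : ℝ) (z : ℂ) : ℂ :=
  bottcherInv c B ((σ : ℂ) / ‖B z‖ * B z)

namespace IsBottcher

variable {c : ℂ} {B : ℂ → ℂ} {a : ℂ} {r σ : ℝ} {z : ℂ}

theorem norm_radial (hB : IsBottcher c B) (hz : z ∈ basinInfty c) (hσ : 1 < σ) :
    ‖(σ : ℂ) / ‖B z‖ * B z‖ = σ := by
  have := hB.one_lt_norm hz
  rw [norm_mul, norm_div, Complex.norm_real, Complex.norm_real, norm_norm,
    Real.norm_of_nonneg (by linarith), div_mul_cancel₀ _ (by linarith)]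

theorem radialPoint_mem (hB : IsBottcher c B) (hz : z ∈ basinInfty c) (hσ : 1 < σ) :
    radialPoint c B σ z ∈ basinInfty c :=
  hB.inv_mem (by rwa [hB.norm_radial hz hσ])

theorem apply_radialPoint (hB : IsBottcher c B) (hz : z ∈ basinInfty c) (hσ : 1 < σ) :
    B (radialPoint c B σ z) = (σ : ℂ) / ‖B z‖ * B z :=
  hB.apply_inv (by rwa [hB.norm_radial hz hσ])

theorem norm_apply_radialPoint (hB : IsBottcher c B) (hz : z ∈ basinInfty c) (hσ : 1 < σ) :
    ‖B (radialPoint c B σ z)‖ = σ := by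
  rw [hB.apply_radialPoint hz hσ, hB.norm_radial hz hσ]

theorem radialPoint_norm (hB : IsBottcher c B) (hz : z ∈ basinInfty c) :
    radialPoint c B ‖B z‖ z = z := by
  have := hB.one_lt_norm hz
  have h0 : (‖B z‖ : ℂ) ≠ 0 := by
    rw [Ne, Complex.ofReal_eq_zero]; linarith
  rw [radialPoint, div_self h0, one_mul, hB.inv_apply hz]

theorem radialPoint_radialPoint (hB : IsBottcher c B) (hz : z ∈ basinInfty c) (hσ : 1 < σ)
    (τ : ℝ) : radialPoint c B τ (radialPoint c B σ z) = radialPoint c B τ z := by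
  have h1 : (σ : ℂ) ≠ 0 := by
    rw [Ne, Complex.ofReal_eq_zero]; linarith
  rw [radialPoint, hB.norm_apply_radialPoint hz hσ, hB.apply_radialPoint hz hσ, radialPoint]
  congr 1
  field_simp

theorem continuousOn_radialPoint_left (hB : IsBottcher c B) (hz : z ∈ basinInfty c) :
    ContinuousOn (fun σ => radialPoint c B σ z) (Ioi 1) := by
  intro σ hσ
  refine ContinuousAt.continuousWithinAt ?_
  refine ContinuousAt.comp (g := bottcherInv c B)
    (hB.continuousAt_inv (by rwa [hB.norm_radial hz hσ])) ?_
  fun_prop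

theorem continuousAt_radialPoint (hB : IsBottcher c B) (hz : z ∈ basinInfty c) (hσ : 1 < σ) :
    ContinuousAt (radialPoint c B σ) z := by
  refine ContinuousAt.comp (g := bottcherInv c B)
    (hB.continuousAt_inv (by rwa [hB.norm_radial hz hσ])) ?_
  have h1 := hB.continuousAt hz
  have h0 : (‖B z‖ : ℂ) ≠ 0 := by
    have := hB.one_lt_norm hz
    rw [Ne, Complex.ofReal_eq_zero]; linarith
  exact (continuousAt_const.div (Complex.continuous_ofReal.continuousAt.comp h1.norm) h0).mul h1

theorem radialPoint_mem_polyCutRegion (hB : IsBottcher c B) (haK : a ∉ basinInfty c)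
    (hz : z ∈ basinInfty c) (hzG : z ∈ polyCutRegion c B a r) (hσ : 1 < σ) (hσr : σ < r) :
    radialPoint c B σ z ∈ polyCutRegion c B a r := by
  have hm := hB.radialPoint_mem hz hσ
  refine ⟨fun _ => by rwa [hB.norm_apply_radialPoint hz hσ], fun h => haK (h ▸ hm), ?_⟩
  intro t ht hray
  refine hzG.2.2 t ht (hB.mem_externalRay hz ?_)
  have h1 := eq_norm_mul_of_mem_externalRay hray
  rw [hB.norm_apply_radialPoint hz hσ, hB.apply_radialPoint hz hσ] at h1
  have h0 : (σ : ℂ) ≠ 0 := by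
    rw [Ne, Complex.ofReal_eq_zero]; linarith
  have h2 : (‖B z‖ : ℂ) ≠ 0 := by
    have := hB.one_lt_norm hz
    rw [Ne, Complex.ofReal_eq_zero]; linarith
  rw [div_mul_eq_mul_div, div_eq_iff h2] at h1
  apply mul_left_cancel₀ h0
  rw [h1]
  ring

/-- The part of a ray between levels $1$ and $r$ is connected and misses the cuts as soon as one of
its points does. -/
theorem radialPoint_mem_component (hB : IsBottcher c B) (haK : a ∉ basinInfty c) {p : ℂ}
    (hz : z ∈ basinInfty c) (hzC : z ∈ connectedComponentIn (polyCutRegion c B a r) p)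
    (hσ : 1 < σ) (hσr : σ < r) :
    radialPoint c B σ z ∈ connectedComponentIn (polyCutRegion c B a r) p := by
  have hzG := connectedComponentIn_subset _ _ hzC
  rw [connectedComponentIn_eq hzC]
  have hseg : IsPreconnected ((fun τ => radialPoint c B τ z) '' Ioo 1 r) :=
    isPreconnected_Ioo.image _ ((hB.continuousOn_radialPoint_left hz).mono fun _ h => h.1)
  refine hseg.subset_connectedComponentIn
    ⟨‖B z‖, ⟨hB.one_lt_norm hz, hzG.1 hz⟩, hB.radialPoint_norm hz⟩ ?_ ⟨σ, ⟨hσ, hσr⟩, rfl⟩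
  rintro _ ⟨τ, hτ, rfl⟩
  exact hB.radialPoint_mem_polyCutRegion haK hz hzG hτ.1 hτ.2

theorem radialPoint_mem_closure_component (hB : IsBottcher c B) (haK : a ∉ basinInfty c) {p : ℂ}
    (hz : z ∈ basinInfty c) (hzC : z ∈ closure (connectedComponentIn (polyCutRegion c B a r) p))
    (hσ : 1 < σ) (hσr : σ < r) :
    radialPoint c B σ z ∈ closure (connectedComponentIn (polyCutRegion c B a r) p) :=
  (hB.continuousAt_radialPoint hz hσ).continuousWithinAt.mem_closure
    ((isOpen_basinInfty c).inter_closure ⟨hz, hzC⟩)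
    fun _ hy => hB.radialPoint_mem_component haK hy.1 hy.2 hσ hσr

end IsBottcher

/-- `A` may meet the boundary of the basin, where continuity of `B` says nothing. Complements of the
closed superlevel sets serve as the open cover. -/
theorem IsBottcher.exists_norm_le_of_isCompact {c : ℂ} {B : ℂ → ℂ} (hB : IsBottcher c B) {A : Set ℂ}
    (hA : IsCompact A) : ∃ M : ℝ, ∀ z ∈ A, z ∈ basinInfty c → ‖B z‖ ≤ M := by
  obtain ⟨t, ht⟩ := hA.elim_finite_subcover
    (fun n : ℕ => {z | z ∈ basinInfty c ∧ (n : ℝ) + 2 ≤ ‖B z‖}ᶜ)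
    (fun n => (hB.isClosed_superlevel (by linarith [n.cast_nonneg (α := ℝ)])).isOpen_compl)
    (fun z _ => by
      obtain ⟨n, hn⟩ := exists_nat_gt ‖B z‖
      exact mem_iUnion.2 ⟨n, fun h => by linarith [h.2]⟩)
  refine ⟨(t.sup id : ℕ) + 2, fun z hz hzb => ?_⟩
  obtain ⟨n, hn, hzn⟩ := mem_iUnion₂.1 (ht hz)
  have h1 : (n : ℝ) ≤ (t.sup id : ℕ) := by exact_mod_cast Finset.le_sup (f := id) hn
  have h2 : ‖B z‖ < n + 2 := not_le.1 fun h => hzn ⟨hzb, h⟩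
  linarith

/-! ### Pieces of depth zero -/

/-- The components of an open set are relatively closed in it. -/
theorem mem_connectedComponentIn_of_mem_closure {X : Type*} [TopologicalSpace X]
    [LocallyConnectedSpace X] {G : Set X} (hG : IsOpen G) {p x : X} (hx : x ∈ G)
    (hxc : x ∈ closure (connectedComponentIn G p)) : x ∈ connectedComponentIn G p := by
  obtain ⟨u, hu1, hu2⟩ := mem_closure_iff.1 hxc _ (hG.connectedComponentIn (x := x))
    (mem_connectedComponentIn hx)
  rw [connectedComponentIn_eq hu2, ← connectedComponentIn_eq hu1]
  exact mem_connectedComponentIn hx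

/-- `a` is a fixed point of `z ↦ z² + c` in the filled Julia set, other than the critical point, at
which finitely many external rays land. -/
structure IsCutPoint (c : ℂ) (B : ℂ → ℂ) (a : ℂ) : Prop where
  bottcher : IsBottcher c B
  fixed : quadPoly c a = a
  notMem : a ∉ basinInfty c
  ne_zero : a ≠ 0
  finite : {t | t ∈ Ico (0 : ℝ) 1 ∧ RayLandsAt c B t a}.Finite

/-- The puzzle pieces of depth zero of `z ↦ z² + c`. -/
def IsPolyPieceZero (c : ℂ) (B : ℂ → ℂ) (a : ℂ) (r : ℝ) (Y : Set ℂ) : Prop :=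
  ∃ x ∈ polyCutRegion c B a r, Y = closure (connectedComponentIn (polyCutRegion c B a r) x)

namespace IsCutPoint

variable {c : ℂ} {B : ℂ → ℂ} {a : ℂ} {r : ℝ}

theorem isOpen_polyCutRegion (ha : IsCutPoint c B a) (hr : 1 < r) :
    IsOpen (polyCutRegion c B a r) :=
  ha.bottcher.isOpen_polyCutRegion hr ha.finite

end IsCutPoint

namespace IsPolyPieceZero

variable {c : ℂ} {B : ℂ → ℂ} {a : ℂ} {r : ℝ} {Y Y' : Set ℂ}

theorem subset_closedLevelRegion (hY : IsPolyPieceZero c B a r Y) (ha : IsCutPoint c B a) :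
    Y ⊆ closedLevelRegion c B r := by
  obtain ⟨x, hx, rfl⟩ := hY
  refine closure_minimal (fun y hy => ?_) (ha.bottcher.isCompact_closedLevelRegion r).isClosed
  exact fun hyb => ((connectedComponentIn_subset _ _ hy).1 hyb).le

theorem isCompact (hY : IsPolyPieceZero c B a r Y) (ha : IsCutPoint c B a) : IsCompact Y := by
  refine (ha.bottcher.isCompact_closedLevelRegion r).of_isClosed_subset ?_
    (hY.subset_closedLevelRegion ha)
  obtain ⟨x, hx, rfl⟩ := hY
  exact isClosed_closure

theorem isPreconnected (hY : IsPolyPieceZero c B a r Y) : IsPreconnected Y := by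
  obtain ⟨x, hx, rfl⟩ := hY
  exact isPreconnected_connectedComponentIn.closure

theorem eq_of_mem (hY : IsPolyPieceZero c B a r Y) (hY' : IsPolyPieceZero c B a r Y')
    (ha : IsCutPoint c B a) (hr : 1 < r) {x : ℂ} (hx : x ∈ polyCutRegion c B a r) (hxY : x ∈ Y)
    (hxY' : x ∈ Y') : Y = Y' := by
  have hG := ha.isOpen_polyCutRegion hr
  obtain ⟨y, hy, rfl⟩ := hY
  obtain ⟨y', hy', rfl⟩ := hY'
  rw [connectedComponentIn_eq (mem_connectedComponentIn_of_mem_closure hG hx hxY),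
    connectedComponentIn_eq (mem_connectedComponentIn_of_mem_closure hG hx hxY')]

theorem eq_of_mem_interior (hY : IsPolyPieceZero c B a r Y) (hY' : IsPolyPieceZero c B a r Y')
    (ha : IsCutPoint c B a) (hr : 1 < r) {x : ℂ} (hxY : x ∈ interior Y) (hxY' : x ∈ Y') :
    Y = Y' := by
  have h2 := hY'
  obtain ⟨y', hy', rfl⟩ := hY'
  obtain ⟨u, hu1, hu2⟩ := mem_closure_iff.1 hxY' _ isOpen_interior hxY
  exact hY.eq_of_mem h2 ha hr (connectedComponentIn_subset _ _ hu2) (interior_subset hu1)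
    (subset_closure hu2)

theorem mem_interior (hY : IsPolyPieceZero c B a r Y) (ha : IsCutPoint c B a) (hr : 1 < r) {x : ℂ}
    (hx : x ∈ polyCutRegion c B a r) (hxY : x ∈ Y) : x ∈ interior Y := by
  have hG := ha.isOpen_polyCutRegion hr
  obtain ⟨y, hy, rfl⟩ := hY
  exact interior_maximal subset_closure hG.connectedComponentIn
    (mem_connectedComponentIn_of_mem_closure hG hx hxY)

/-- A bounded open set `D` off `Y` with frontier in `Y` has no escaping point. Nonescaping points of
`Y` other than `a` are interior to `Y`, so the frontier of `D` reduces to at most `a`. -/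
theorem isFull (hY : IsPolyPieceZero c B a r Y) (ha : IsCutPoint c B a) (hr : 1 < r) :
    IsFull Y := by
  have hB := ha.bottcher
  have hYL := hY.subset_closedLevelRegion ha
  intro D₁ hD₁ hb₁ hfr₁
  set D := D₁ \ Y
  have hYc : IsClosed Y := (hY.isCompact ha).isClosed
  have hD : IsOpen D := hD₁.sdiff hYc
  have hb : Bornology.IsBounded D := hb₁.subset sdiff_subset
  have hfr : frontier D ⊆ Y := by
    rw [hD.frontier_eq]
    rintro x ⟨hx, hxn⟩
    by_contra hxY
    refine hxY (hfr₁ ⟨closure_mono sdiff_subset hx, fun hxi => hxn ⟨interior_subset hxi, hxY⟩⟩)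
  suffices hempty : D = ∅ from sdiff_eq_empty.1 hempty
  -- The ray followed outward from `y` must leave the bounded set `D`, at a point of `Y`. Sliding
  -- back down the ray from there stays in `Y` and ends at `y`.
  have hray : ∀ y ∈ D, y ∉ basinInfty c := by
    intro y hyD hyb
    have h1y := hB.one_lt_norm hyb
    set R : Set ℂ := (fun σ => radialPoint c B σ y) '' Ici ‖B y‖
    have hR : IsPreconnected R := isPreconnected_Ici.image _
      ((hB.continuousOn_radialPoint_left hyb).mono fun σ hσ => h1y.trans_le hσ)
    have hyR : y ∈ R := ⟨‖B y‖, self_mem_Ici, hB.radialPoint_norm hyb⟩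
    have hnot : ¬ Disjoint R (frontier D) := by
      intro hdis
      have hsub := hR.subset_of_disjoint_frontier hD ⟨y, hyR, hyD⟩ hdis
      obtain ⟨M, hM⟩ := hB.exists_norm_le_of_isCompact hb.isCompact_closure
      have h1M : 1 < max ‖B y‖ (M + 1) := h1y.trans_le (le_max_left _ _)
      have h2 := hM _ (subset_closure (hsub ⟨max ‖B y‖ (M + 1), mem_Ici.2 (le_max_left _ _), rfl⟩))
        (hB.radialPoint_mem hyb h1M)
      rw [hB.norm_apply_radialPoint hyb h1M] at h2
      linarith [le_max_right ‖B y‖ (M + 1)]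
    obtain ⟨x, ⟨σ, hσ, rfl⟩, hx⟩ := not_disjoint_iff.1 hnot
    have hσ1 : 1 < σ := h1y.trans_le hσ
    have hσr : σ ≤ r := by
      have := hYL (hfr hx) (hB.radialPoint_mem hyb hσ1)
      rwa [hB.norm_apply_radialPoint hyb hσ1] at this
    rcases (show ‖B y‖ ≤ σ from hσ).eq_or_lt with h | h
    · rw [← h] at hx
      simp only [hB.radialPoint_norm hyb] at hx
      exact (isOpen_disjoint_frontier hD).notMem_of_mem_left hyD hx
    · refine hyD.2 ?_
      have h3 := hfr hx
      obtain ⟨p, hp, rfl⟩ := hY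
      have h4 := hB.radialPoint_mem_closure_component ha.notMem (hB.radialPoint_mem hyb hσ1) h3 h1y
        (h.trans_le hσr)
      rwa [hB.radialPoint_radialPoint hyb hσ1, hB.radialPoint_norm hyb] at h4
  refine eq_empty_of_frontier_subset_singleton (a := a) hD hb fun x hx => ?_
  by_contra hxa
  have hxK : x ∉ basinInfty c := fun hxb => by
    obtain ⟨u, hu1, hu2⟩ := mem_closure_iff.1 hx.1 _ (isOpen_basinInfty c) hxb
    exact hray u hu2 hu1
  have h5 := hY.mem_interior ha hr (mem_polyCutRegion_of_notMem_basinInfty hxK hxa) (hfr hx)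
  obtain ⟨u, hu1, hu2⟩ := mem_closure_iff.1 hx.1 _ isOpen_interior h5
  exact hu2.2 (interior_subset hu1)

/-- A component without escaping points would have frontier in `{a}`, hence be empty. From one
escaping point every level is reached along its ray. -/
theorem exists_mem_basinInfty (hY : IsPolyPieceZero c B a r Y) (ha : IsCutPoint c B a)
    (hr : 1 < r) {σ : ℝ} (hσ : 1 < σ) (hσr : σ < r) :
    ∃ y ∈ Y, y ∈ basinInfty c ∧ ‖B y‖ = σ := by
  have hB := ha.bottcher
  have hG := ha.isOpen_polyCutRegion hr
  have hb := (hY.isCompact ha).isBounded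
  obtain ⟨p, hp, rfl⟩ := hY
  set C := connectedComponentIn (polyCutRegion c B a r) p
  obtain ⟨x, hxC, hxb⟩ : ∃ x ∈ C, x ∈ basinInfty c := by
    by_contra! hcon
    have hC : IsOpen C := hG.connectedComponentIn
    have hemp : C = ∅ := by
      refine eq_empty_of_frontier_subset_singleton (a := a) hC (hb.subset subset_closure)
        fun x hx => ?_
      by_contra hxa
      have hxK : x ∉ basinInfty c := fun hxb => by
        obtain ⟨u, hu1, hu2⟩ := mem_closure_iff.1 hx.1 _ (isOpen_basinInfty c) hxb
        exact hcon u hu2 hu1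
      exact (isOpen_disjoint_frontier hC).notMem_of_mem_left
        (mem_connectedComponentIn_of_mem_closure hG
          (mem_polyCutRegion_of_notMem_basinInfty hxK hxa) hx.1) hx
    exact (hemp ▸ mem_connectedComponentIn hp : p ∈ (∅ : Set ℂ))
  exact ⟨_, subset_closure (hB.radialPoint_mem_component ha.notMem hxb hxC hσ hσr),
    hB.radialPoint_mem hxb hσ, hB.norm_apply_radialPoint hxb hσ⟩

/-- No iterate maps a piece of depth zero into a piece of depth zero. -/
theorem not_image_subset (hY : IsPolyPieceZero c B a r Y) (hY' : IsPolyPieceZero c B a r Y')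
    (ha : IsCutPoint c B a) (hr : 1 < r) {m : ℕ} (hm : m ≠ 0) :
    ¬ (quadPoly c)^[m] '' Y ⊆ Y' := by
  intro hsub
  have hs : 1 < √r := by rw [Real.lt_sqrt zero_le_one]; simpa using hr
  have hsr : √r < r := by
    nlinarith [Real.sq_sqrt (show 0 ≤ r by linarith)]
  -- Any level strictly between $\sqrt r$ and $r$ serves: one squaring already pushes it above $r$.
  obtain ⟨y, hy, hyb, hys⟩ := hY.exists_mem_basinInfty ha hr (σ := (√r + r) / 2)
    (by linarith) (by linarith)
  have h1 := hY'.subset_closedLevelRegion ha (hsub ⟨y, hy, rfl⟩)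
    ((mem_basinInfty_quadPoly_iterate c m).2 hyb)
  rw [ha.bottcher.norm_quadPoly_iterate hyb, hys] at h1
  have h2 : ((√r + r) / 2) ^ 2 ≤ ((√r + r) / 2) ^ 2 ^ m :=
    pow_le_pow_right₀ (by linarith) (Nat.le_self_pow hm 2)
  nlinarith [Real.sq_sqrt (show 0 ≤ r by linarith)]

end IsPolyPieceZero

/-! ### Deeper pieces: injectivity and nesting -/

theorem quadPoly_iterate_neg (c : ℂ) {m : ℕ} (hm : m ≠ 0) (z : ℂ) :
    (quadPoly c)^[m] (-z) = (quadPoly c)^[m] z := by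
  obtain ⟨m, rfl⟩ := Nat.exists_eq_succ_of_ne_zero hm
  rw [Function.iterate_succ_apply, Function.iterate_succ_apply, quadPoly_neg]

theorem IsPreconnected.neg_complex {S : Set ℂ} (hS : IsPreconnected S) :
    IsPreconnected ((fun z => -z) '' S) :=
  hS.image _ continuous_neg.continuousOn

/-- The iterate `f^[i]` maps the component of `f^[m + i]⁻¹(T)` at `x` into the component of
`f^[m]⁻¹(T)` at `f^[i] x`. -/
theorem Continuous.mapsTo_iterate_connectedComponentIn {X : Type*} [TopologicalSpace X] {f : X → X}
    (hf : Continuous f) {T : Set X} {m i N : ℕ} (hN : N = m + i) {x y : X}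
    (hy : y ∈ connectedComponentIn (f^[N] ⁻¹' T) x) :
    MapsTo f^[i] (connectedComponentIn (f^[N] ⁻¹' T) x)
      (connectedComponentIn (f^[m] ⁻¹' T) (f^[i] y)) := by
  subst hN
  rw [connectedComponentIn_eq hy]
  refine mapsTo_iff_image_subset.2 ?_
  refine (isPreconnected_connectedComponentIn.image _
    (hf.iterate i).continuousOn).subset_connectedComponentIn ?_ ?_
  · exact ⟨y, mem_connectedComponentIn (connectedComponentIn_subset _ _ hy), rfl⟩
  · rintro _ ⟨u, hu, rfl⟩
    have := connectedComponentIn_subset _ _ hu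
    rwa [mem_preimage, Function.iterate_add_apply] at this

namespace IsPolyPieceZero

variable {c : ℂ} {B : ℂ → ℂ} {a : ℂ} {r : ℝ} {Y : Set ℂ}

theorem preimage_subset_closedLevelRegion (hY : IsPolyPieceZero c B a r Y)
    (ha : IsCutPoint c B a) (n : ℕ) : (quadPoly c)^[n] ⁻¹' Y ⊆ closedLevelRegion c B r := by
  intro z hz
  replace hz := hY.subset_closedLevelRegion ha hz
  induction n with
  | zero => exact hz
  | succ n ih =>
    rw [Function.iterate_succ_apply'] at hz
    exact ih (ha.bottcher.mem_closedLevelRegion_of_quadPoly_mem hz)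

theorem isCompact_preimage (hY : IsPolyPieceZero c B a r Y) (ha : IsCutPoint c B a) (n : ℕ) :
    IsCompact ((quadPoly c)^[n] ⁻¹' Y) :=
  (ha.bottcher.isCompact_closedLevelRegion r).of_isClosed_subset
    ((hY.isCompact ha).isClosed.preimage (continuous_quadPoly_iterate c n))
    (hY.preimage_subset_closedLevelRegion ha n)

/-- The polynomial is injective on pieces which do not contain the critical point. -/
theorem injOn_component (hY : IsPolyPieceZero c B a r Y) (ha : IsCutPoint c B a) (hr : 1 < r)
    {m : ℕ} (hm : m ≠ 0) {x : ℂ} (h0 : (0 : ℂ) ∉ connectedComponentIn ((quadPoly c)^[m] ⁻¹' Y) x) :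
    InjOn (quadPoly c) (connectedComponentIn ((quadPoly c)^[m] ⁻¹' Y) x) := by
  intro u hu v hv huv
  rcases (quadPoly_eq_iff c).1 huv with h | h
  · exact h
  -- Here $u=-v$. Since $m\ne 0$ the full preimage is symmetric, so the component, meeting its own
  -- reflection, is a symmetric full continuum and contains $0$.
  refine (h0 ?_).elim
  refine IsFull.zero_mem_of_neg_mem (isFull_connectedComponentIn ((hY.isFull ha hr).preimage
    (isOpenMap_quadPoly_iterate c m) (continuous_quadPoly_iterate c m)) x)
    ((hY.isCompact_preimage ha m).connectedComponentIn x) isPreconnected_connectedComponentIn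
    ⟨u, hu⟩ fun z hz => ?_
  rw [connectedComponentIn_eq hu]
  refine (isPreconnected_connectedComponentIn (F := (quadPoly c)^[m] ⁻¹' Y) (x := x)
    ).neg_complex.subset_connectedComponentIn ⟨v, hv, h.symm⟩ ?_ ⟨z, hz, rfl⟩
  rintro _ ⟨y, hy, rfl⟩
  have := connectedComponentIn_subset _ _ hy
  rwa [mem_preimage, ← quadPoly_iterate_neg c hm] at this

theorem exists_superset_of_isPreconnected
    {D W : Set ℂ} (hD : IsPreconnected D) (hDG : D ⊆ polyCutRegion c B a r) (hWD : W ⊆ closure D)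
    (hW : W.Nonempty) : ∃ Y', IsPolyPieceZero c B a r Y' ∧ W ⊆ Y' := by
  obtain ⟨w, hw⟩ := hW
  obtain ⟨d, hd⟩ := closure_nonempty_iff.1 ⟨w, hWD hw⟩
  exact ⟨_, ⟨d, hDG hd, rfl⟩,
    hWD.trans (closure_mono (hD.subset_connectedComponentIn hd hDG))⟩

/-- Every piece of depth one is contained in a piece of depth zero. -/
theorem exists_superset_of_depth_one (hY : IsPolyPieceZero c B a r Y) (ha : IsCutPoint c B a)
    (hr : 1 < r) {x : ℂ} (hx : quadPoly c x ∈ Y) :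
    ∃ Y', IsPolyPieceZero c B a r Y' ∧ connectedComponentIn (quadPoly c ⁻¹' Y) x ⊆ Y' := by
  have hB := ha.bottcher
  have hG := ha.isOpen_polyCutRegion hr
  have hcpt : IsCompact (quadPoly c ⁻¹' Y) := hY.isCompact_preimage ha 1
  have hYp := hY.isPreconnected
  set W := connectedComponentIn (quadPoly c ⁻¹' Y) x
  have hWY : W ⊆ quadPoly c ⁻¹' Y := connectedComponentIn_subset _ _
  have hWne : W.Nonempty := ⟨x, mem_connectedComponentIn hx⟩
  have hWc : IsCompact W := hcpt.connectedComponentIn x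
  -- Backward invariance concerns only the open cut region, while `W` may touch the cuts. So `W` is
  -- exhibited inside the closure of a connected set lying over the open component `C`.
  by_cases h0 : (0 : ℂ) ∈ W
  · obtain ⟨p, hp, rfl⟩ := hY
    set C := connectedComponentIn (polyCutRegion c B a r) p
    have hC : IsOpen C := hG.connectedComponentIn
    have h0K := hB.zero_notMem
    -- The critical value is nonescaping and differs from `a`, because the fibre over `a` is
    -- $\{a,-a\}$ and $a\ne0$. Hence it lies in the open component, not merely in its closure.
    have hcC : quadPoly c 0 ∈ C := by
      refine mem_connectedComponentIn_of_mem_closure hG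
        (mem_polyCutRegion_of_notMem_basinInfty ?_ ?_) (hWY h0)
      · rwa [mem_basinInfty_quadPoly]
      · intro h
        rw [← ha.fixed, quadPoly_eq_iff, zero_eq_neg] at h
        exact ha.ne_zero (h.elim Eq.symm id)
    set D := connectedComponentIn (quadPoly c ⁻¹' C) 0
    have hpre : IsOpen (quadPoly c ⁻¹' C) := hC.preimage (continuous_quadPoly c)
    have hD : IsOpen D := hpre.connectedComponentIn
    have h0D : (0 : ℂ) ∈ D := mem_connectedComponentIn hcC
    have hDC : D ⊆ quadPoly c ⁻¹' C := connectedComponentIn_subset _ _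
    have hDsub : closure D ⊆ quadPoly c ⁻¹' closure C :=
      closure_minimal (hDC.trans (preimage_mono subset_closure)) hcpt.isClosed
    have hDcpt : IsCompact (closure D) := hcpt.of_isClosed_subset isClosed_closure hDsub
    have hDneg : ∀ z ∈ D, -z ∈ D := by
      intro z hz
      refine (isPreconnected_connectedComponentIn (F := quadPoly c ⁻¹' C) (x := 0)
        ).neg_complex.subset_connectedComponentIn ⟨0, h0D, neg_zero⟩ ?_ ⟨z, hz, rfl⟩
      rintro _ ⟨y, hy, rfl⟩
      rw [mem_preimage, quadPoly_neg]
      exact hDC hy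
    have hCD : C ⊆ quadPoly c '' D := by
      refine isPreconnected_connectedComponentIn.subset_of_disjoint_frontier
        (isOpenMap_quadPoly c _ hD) ⟨_, hcC, 0, h0D, rfl⟩ ?_
      rw [disjoint_left]
      intro y hyC hy
      have h1 : closure (quadPoly c '' D) ⊆ quadPoly c '' closure D :=
        closure_minimal (image_mono subset_closure)
          (hDcpt.image (continuous_quadPoly c)).isClosed
      obtain ⟨d, hd, rfl⟩ := h1 hy.1
      exact (isOpen_disjoint_frontier (isOpenMap_quadPoly c _ hD)).notMem_of_mem_left
        ⟨d, mem_connectedComponentIn_of_mem_closure hpre hyC hd, rfl⟩ hy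
    -- Since `D` is symmetric and maps onto `C`, it contains both preimages of every point: the
    -- preimage of `C` is connected.
    have hDeq : quadPoly c ⁻¹' C ⊆ D := by
      intro z hz
      obtain ⟨d, hd, hdz⟩ := hCD hz
      rcases (quadPoly_eq_iff c).1 hdz with h | h
      · exact h ▸ hd
      · rw [← neg_eq_iff_eq_neg] at h
        exact h ▸ hDneg d hd
    refine exists_superset_of_isPreconnected (D := D) isPreconnected_connectedComponentIn ?_ ?_
      hWne
    · exact fun z hz => hB.mem_polyCutRegion_of_quadPoly_mem ha.fixed
        (connectedComponentIn_subset _ _ (hDC hz))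
    · exact (connectedComponentIn_subset _ _).trans
        ((isOpenMap_quadPoly c).preimage_closure_subset_closure_preimage.trans (closure_mono hDeq))
  -- Without the critical point, `W` maps homeomorphically onto `Y`, and the inverse branch carries
  -- `C` to a connected set whose closure contains `W`.
  · have hinj : InjOn (quadPoly c) W := hY.injOn_component ha hr one_ne_zero h0
    have himg : quadPoly c '' W = Y :=
      (isOpenMap_quadPoly c).image_connectedComponentIn_preimage (continuous_quadPoly c) hYp hcpt hx
    set g := Function.invFunOn (quadPoly c) W
    have hbij : BijOn (quadPoly c) W Y := ⟨mapsTo_iff_image_subset.2 himg.subset, hinj,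
      himg.symm.subset⟩
    have hinv := hbij.invOn_invFunOn
    have hgm : MapsTo g Y W := hbij.surjOn.mapsTo_invFunOn
    have hg : ContinuousOn g Y := by
      rw [continuousOn_iff_isClosed]
      intro t ht
      refine ⟨quadPoly c '' (W ∩ t), ((hWc.inter_right ht).image (continuous_quadPoly c)).isClosed,
        ?_⟩
      ext y
      constructor
      · rintro ⟨hyt, hy⟩
        exact ⟨⟨g y, ⟨hgm hy, hyt⟩, hinv.2 hy⟩, hy⟩
      · rintro ⟨⟨w, ⟨hw, hwt⟩, rfl⟩, hy⟩
        refine ⟨?_, hy⟩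
        rw [mem_preimage, show g (quadPoly c w) = w from hinv.1 hw]
        exact hwt
    obtain ⟨p, hp, rfl⟩ := hY
    set C := connectedComponentIn (polyCutRegion c B a r) p
    refine exists_superset_of_isPreconnected (D := g '' C)
      (isPreconnected_connectedComponentIn.image _ (hg.mono subset_closure)) ?_ ?_ hWne
    · rintro _ ⟨y, hy, rfl⟩
      refine hB.mem_polyCutRegion_of_quadPoly_mem ha.fixed ?_
      rw [show quadPoly c (g y) = y from hinv.2 (subset_closure hy)]
      exact connectedComponentIn_subset _ _ hy
    · intro w hw
      have h1 := hg.image_closure ⟨quadPoly c w, hbij.mapsTo hw, rfl⟩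
      rwa [show g (quadPoly c w) = w from hinv.1 hw] at h1

/-- Every piece is contained in a piece of depth zero. -/
theorem exists_superset (ha : IsCutPoint c B a) (hr : 1 < r) (M : ℕ) :
    ∀ {Y : Set ℂ}, IsPolyPieceZero c B a r Y → ∀ {x : ℂ}, (quadPoly c)^[M] x ∈ Y →
    ∃ Y', IsPolyPieceZero c B a r Y' ∧ connectedComponentIn ((quadPoly c)^[M] ⁻¹' Y) x ⊆ Y' := by
  induction M with
  | zero => exact fun {Y} hY {x} _ => ⟨Y, hY, connectedComponentIn_subset _ _⟩
  | succ M ih =>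
    intro Y hY x hx
    have hx1 : quadPoly c ((quadPoly c)^[M] x) ∈ Y := by
      rwa [Function.iterate_succ_apply'] at hx
    obtain ⟨Y₁, hY₁, hsub₁⟩ := hY.exists_superset_of_depth_one ha hr hx1
    have hxW := mem_connectedComponentIn (F := (quadPoly c)^[M + 1] ⁻¹' Y) hx
    have hmaps := (continuous_quadPoly c).mapsTo_iterate_connectedComponentIn (T := Y)
      (m := 1) (i := M) (add_comm M 1) hxW
    rw [Function.iterate_one] at hmaps
    obtain ⟨Y₂, hY₂, hsub₂⟩ := ih hY₁ (hsub₁ (hmaps hxW))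
    refine ⟨Y₂, hY₂, Subset.trans ?_ hsub₂⟩
    exact isPreconnected_connectedComponentIn.subset_connectedComponentIn hxW
      fun w hw => hsub₁ (hmaps hw)

end IsPolyPieceZero

/-! ### The univalent pull-back for the polynomial -/

/-- The pieces of depth `n` of `z ↦ z² + c`, with their images of depth zero. -/
def IsPolyPiece (c : ℂ) (B : ℂ → ℂ) (a : ℂ) (r : ℝ) (n : ℕ) (Y V : Set ℂ) : Prop :=
  IsPolyPieceZero c B a r Y ∧
    ∃ x ∈ (quadPoly c)^[n] ⁻¹' Y, V = connectedComponentIn ((quadPoly c)^[n] ⁻¹' Y) x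

namespace IsPolyPiece

variable {c : ℂ} {B : ℂ → ℂ} {a : ℂ} {r : ℝ} {n N k l : ℕ} {Y Y₀ V V₀ : Set ℂ}

theorem subset_preimage (hV : IsPolyPiece c B a r n Y V) : V ⊆ (quadPoly c)^[n] ⁻¹' Y := by
  obtain ⟨-, x, hx, rfl⟩ := hV
  exact connectedComponentIn_subset _ _

theorem eq_component (hV : IsPolyPiece c B a r n Y V) {x : ℂ} (hx : x ∈ V) :
    V = connectedComponentIn ((quadPoly c)^[n] ⁻¹' Y) x := by
  obtain ⟨-, y, hy, rfl⟩ := hV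
  exact connectedComponentIn_eq hx

theorem isPreconnected (hV : IsPolyPiece c B a r n Y V) : IsPreconnected V := by
  obtain ⟨-, y, hy, rfl⟩ := hV
  exact isPreconnected_connectedComponentIn

theorem image_eq (hV : IsPolyPiece c B a r n Y V) (ha : IsCutPoint c B a) :
    (quadPoly c)^[n] '' V = Y := by
  obtain ⟨hY, y, hy, rfl⟩ := hV
  exact (isOpenMap_quadPoly_iterate c n).image_connectedComponentIn_preimage
    (continuous_quadPoly_iterate c n) hY.isPreconnected (hY.isCompact_preimage ha n) hy

theorem mem_interior (hV : IsPolyPiece c B a r n Y V) {x : ℂ} (hx : x ∈ V)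
    (hxY : (quadPoly c)^[n] x ∈ interior Y) : x ∈ interior V := by
  have ho : IsOpen ((quadPoly c)^[n] ⁻¹' interior Y) :=
    isOpen_interior.preimage (continuous_quadPoly_iterate c n)
  refine _root_.mem_interior.2 ⟨connectedComponentIn ((quadPoly c)^[n] ⁻¹' interior Y) x, ?_,
    ho.connectedComponentIn, mem_connectedComponentIn hxY⟩
  rw [hV.eq_component hx]
  exact connectedComponentIn_mono _ (preimage_mono interior_subset)

theorem apply_mem_interior (hV : IsPolyPiece c B a r n Y V) {x : ℂ} (hx : x ∈ interior V) :
    (quadPoly c)^[n] x ∈ interior Y :=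
  _root_.mem_interior.2 ⟨(quadPoly c)^[n] '' interior V,
    image_subset_iff.2 (interior_subset.trans hV.subset_preimage),
    isOpenMap_quadPoly_iterate c n _ isOpen_interior, x, hx, rfl⟩

/-- Otherwise a positive iterate would carry `Y` into `Y₀`, which the levels forbid. -/
theorem depth_le (hV : IsPolyPiece c B a r n Y V) (hV₀ : IsPolyPiece c B a r N Y₀ V₀)
    (ha : IsCutPoint c B a) (hr : 1 < r) (himg : (quadPoly c)^[k] '' V₀ = V) : N ≤ n + k := by
  by_contra hlt
  obtain ⟨m, rfl⟩ : ∃ m, N = m + (n + k) := ⟨N - (n + k), by omega⟩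
  refine hV.1.not_image_subset hV₀.1 ha hr (m := m) (by omega) ?_
  rw [← hV.image_eq ha, ← himg, ← image_comp, ← image_comp, ← Function.iterate_add,
    ← Function.iterate_add, add_assoc]
  exact image_subset_iff.2 hV₀.subset_preimage

theorem iterate_critical_notMem (ha : IsCutPoint c B a) (i : ℕ) :
    (quadPoly c)^[i] 0 ∉ basinInfty c := by
  rw [mem_basinInfty_quadPoly_iterate]
  exact ha.bottcher.zero_notMem

/-- Before its first return to the interior of the piece `V`, the orbit of the critical point does
not meet `V`. -/
theorem iterate_critical_notMem_of_lt (hV : IsPolyPiece c B a r n Y V) (ha : IsCutPoint c B a)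
    (hr : 1 < r) (hk : IsLeast {k | 0 < k ∧ (quadPoly c)^[k] 0 ∈ interior V} k) {i : ℕ}
    (hi : 0 < i) (hik : i < k) : (quadPoly c)^[i] 0 ∉ V := by
  intro hiV
  have h1 : (quadPoly c)^[i] 0 ∉ interior V := fun h => absurd (hk.2 ⟨hi, h⟩) (not_le.2 hik)
  have h2 : (quadPoly c)^[n] ((quadPoly c)^[i] 0) ∉ interior Y := fun h => h1 (hV.mem_interior hiV h)
  -- A visit to the boundary of `V` puts the critical orbit on the boundary of `Y`, where the only
  -- nonescaping point can be `a`. The orbit then stays at `a`, yet at time $n+k$ it lies in the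
  -- interior of `Y`.
  have h3 : (quadPoly c)^[n + i] 0 = a := by
    by_contra hne
    rw [← Function.iterate_add_apply] at h2
    refine h2 (hV.1.mem_interior ha hr
      (mem_polyCutRegion_of_notMem_basinInfty (iterate_critical_notMem ha _) hne) ?_)
    rw [Function.iterate_add_apply]
    exact hV.subset_preimage hiV
  have h4 : (quadPoly c)^[n + k] 0 = a := by
    obtain ⟨j, rfl⟩ : ∃ j, k = j + i := ⟨k - i, by omega⟩
    rw [show n + (j + i) = j + (n + i) by ring, Function.iterate_add_apply, h3]
    exact Function.iterate_fixed ha.fixed j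
  have h5 := hV.apply_mem_interior hk.1.2
  rw [← Function.iterate_add_apply] at h2 h5
  rw [h4] at h5
  rw [h3] at h2
  exact h2 h5

/-- The pieces of large depth which contain the critical point lie in the central domain. -/
theorem component_subset_central (hV : IsPolyPiece c B a r n Y V)
    (hV₀ : IsPolyPiece c B a r N Y₀ V₀) (ha : IsCutPoint c B a) (hr : 1 < r)
    (hk : IsLeast {k | 0 < k ∧ (quadPoly c)^[k] 0 ∈ interior V} k) (h0 : (0 : ℂ) ∈ V₀)
    (himg : (quadPoly c)^[k] '' V₀ = V) {m : ℕ} (hm : n + k ≤ m) {x : ℂ}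
    (hx0 : (0 : ℂ) ∈ connectedComponentIn ((quadPoly c)^[m] ⁻¹' Y) x) :
    connectedComponentIn ((quadPoly c)^[m] ⁻¹' Y) x ⊆ V₀ := by
  have hN := hV.depth_le hV₀ ha hr himg
  obtain ⟨M, rfl⟩ : ∃ M, m = M + N := ⟨m - N, by omega⟩
  have hmaps := (continuous_quadPoly c).mapsTo_iterate_connectedComponentIn (T := Y) rfl hx0
  have h0m : (quadPoly c)^[M] ((quadPoly c)^[N] 0) ∈ Y :=
    connectedComponentIn_subset ((quadPoly c)^[M] ⁻¹' Y) _ (hmaps hx0)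
  obtain ⟨Y', hY', hsub⟩ := IsPolyPieceZero.exists_superset ha hr M hV.1 h0m
  have h0Y' : (quadPoly c)^[N] 0 ∈ Y' := hsub (hmaps hx0)
  have h0Y₀ : (quadPoly c)^[N] 0 ∈ Y₀ := hV₀.subset_preimage h0
  -- Both pieces contain the $N$-th critical iterate, which decides the matter unless it is `a`. In
  -- that case `a` is interior to `Y` by the return at time $k$, and both pieces equal `Y`.
  have heq : Y' = Y₀ := by
    by_cases hfix : (quadPoly c)^[N] 0 = a
    · have h5 := hV.apply_mem_interior hk.1.2
      obtain ⟨j, hj⟩ : ∃ j, n + k = j + N := ⟨n + k - N, by omega⟩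
      rw [← Function.iterate_add_apply, hj, Function.iterate_add_apply, hfix,
        Function.iterate_fixed ha.fixed] at h5
      rw [hfix] at h0Y' h0Y₀
      rw [← hV.1.eq_of_mem_interior hY' ha hr h5 h0Y', hV.1.eq_of_mem_interior hV₀.1 ha hr h5 h0Y₀]
    · exact hY'.eq_of_mem hV₀.1 ha hr
        (mem_polyCutRegion_of_notMem_basinInfty (iterate_critical_notMem ha _) hfix) h0Y' h0Y₀
  rw [hV₀.eq_component h0]
  refine isPreconnected_connectedComponentIn.subset_connectedComponentIn hx0 fun w hw => ?_
  have := hsub (hmaps hw)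
  rwa [heq] at this

theorem injOn_and_image_eq (hV : IsPolyPiece c B a r n Y V) (hV₀ : IsPolyPiece c B a r N Y₀ V₀)
    (ha : IsCutPoint c B a) (hr : 1 < r)
    (hk : IsLeast {k | 0 < k ∧ (quadPoly c)^[k] 0 ∈ interior V} k) (h0 : (0 : ℂ) ∈ V₀)
    (hsub : V₀ ⊆ V) (himg : (quadPoly c)^[k] '' V₀ = V) {z : ℂ}
    (hl : IsLeast {k | (quadPoly c)^[k] z ∈ V₀} l) :
    ∃ Ω, IsPolyPiece c B a r (n + l) Y Ω ∧ z ∈ Ω ∧ InjOn (quadPoly c)^[l] Ω ∧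
      (quadPoly c)^[l] '' Ω = V := by
  have hlV : (quadPoly c)^[l] z ∈ V := hsub hl.1
  have hlY : (quadPoly c)^[n + l] z ∈ Y := by
    rw [Function.iterate_add_apply]
    exact hV.subset_preimage hlV
  set Ω := connectedComponentIn ((quadPoly c)^[n + l] ⁻¹' Y) z
  have hz : z ∈ Ω := mem_connectedComponentIn hlY
  have hΩ : IsPolyPiece c B a r (n + l) Y Ω := ⟨hV.1, z, hlY, rfl⟩
  have hmapsV : MapsTo (quadPoly c)^[l] Ω V := by
    have := (continuous_quadPoly c).mapsTo_iterate_connectedComponentIn (T := Y) rfl hz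
    rwa [← hV.eq_component hlV] at this
  refine ⟨Ω, hΩ, hz, ?_, ?_⟩
  -- Here `i` counts the iterates still to be made. For `i < k` the critical orbit would visit `V`
  -- too early; for `k ≤ i` the orbit of `z` would visit `V₀` before time `l`.
  · have hcrit : ∀ i, i ≠ 0 → i ≤ l → (0 : ℂ) ∉
        connectedComponentIn ((quadPoly c)^[n + i] ⁻¹' Y) ((quadPoly c)^[l - i] z) := by
      intro i hi hil h0i
      have hzi : (quadPoly c)^[l - i] z ∈
          connectedComponentIn ((quadPoly c)^[n + i] ⁻¹' Y) ((quadPoly c)^[l - i] z) := by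
        refine mem_connectedComponentIn ?_
        rwa [mem_preimage, ← Function.iterate_add_apply, show n + i + (l - i) = n + l by omega]
      rcases lt_or_ge i k with hik | hik
      · have h1 := (continuous_quadPoly c).mapsTo_iterate_connectedComponentIn (T := Y) rfl hzi
        rw [← Function.iterate_add_apply, show i + (l - i) = l by omega,
          ← hV.eq_component hlV] at h1
        exact hV.iterate_critical_notMem_of_lt ha hr hk (Nat.pos_of_ne_zero hi) hik (h1 h0i)
      · have h1 := hV.component_subset_central hV₀ ha hr hk h0 himg (m := n + i) (by omega) h0i
        have h2 := hl.2 (show l - i ∈ {k | (quadPoly c)^[k] z ∈ V₀} from h1 hzi)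
        omega
    have hind : ∀ j ≤ l, InjOn (quadPoly c)^[j] Ω := by
      intro j
      induction j with
      | zero => exact fun _ => injOn_id _
      | succ j ih =>
        intro hj u hu v hv huv
        refine ih (by omega) hu hv ?_
        have h1 := (continuous_quadPoly c).mapsTo_iterate_connectedComponentIn (T := Y)
          (m := n + (l - j)) (i := j) (by omega) hz
        have h2 := hcrit (l - j) (by omega) (by omega)
        rw [show l - (l - j) = j by omega] at h2
        refine hV.1.injOn_component ha hr (m := n + (l - j)) (by omega) h2 (h1 hu) (h1 hv) ?_
        rwa [Function.iterate_succ_apply', Function.iterate_succ_apply'] at huv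
    exact hind l le_rfl
  · refine hmapsV.image_subset.antisymm ?_
    have hpre : (quadPoly c)^[l] ⁻¹' V ⊆ (quadPoly c)^[n + l] ⁻¹' Y := by
      intro w hw
      rw [mem_preimage, Function.iterate_add_apply]
      exact hV.subset_preimage hw
    have hVc : IsCompact V := by
      rw [hV.eq_component hlV]
      exact (hV.1.isCompact_preimage ha n).connectedComponentIn _
    have hcpt : IsCompact ((quadPoly c)^[l] ⁻¹' V) :=
      (hV.1.isCompact_preimage ha (n + l)).of_isClosed_subset
        (hVc.isClosed.preimage (continuous_quadPoly_iterate c l)) hpre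
    have h1 := (isOpenMap_quadPoly_iterate c l).image_connectedComponentIn_preimage
      (continuous_quadPoly_iterate c l) hV.isPreconnected hcpt hlV
    -- The component of the preimage of `V` at `z` already covers `V`, and it lies in `Ω`.
    exact h1.symm.subset.trans (image_mono (connectedComponentIn_mono _ hpre))

end IsPolyPiece

/-! ### Transport of sets by the homeomorphism -/

section PullBack

variable (h : OpenPartialHomeomorph ℂ ℂ)

/-- The subset of the domain of `h` which corresponds to `A`. -/
def pullBack (A : Set ℂ) : Set ℂ :=
  {z | z ∈ h.source ∧ h z ∈ A}

variable {h}

theorem pullBack_eq_image {A : Set ℂ} (hA : A ⊆ h.target) : pullBack h A = h.symm '' A :=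
  (h.symm_image_eq_source_inter_preimage hA).symm

theorem image_pullBack {A : Set ℂ} (hA : A ⊆ h.target) : h '' pullBack h A = A := by
  refine Subset.antisymm (fun _ ⟨z, hz, hzw⟩ => hzw ▸ hz.2) fun w hw => ?_
  exact ⟨h.symm w, ⟨h.map_target (hA hw), by rwa [h.right_inv (hA hw)]⟩, h.right_inv (hA hw)⟩

theorem connectedComponentIn_pullBack {S : Set ℂ} (hS : S ⊆ h.target) {x : ℂ}
    (hx : x ∈ pullBack h S) :
    connectedComponentIn (pullBack h S) x = pullBack h (connectedComponentIn S (h x)) := by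
  have hsub : connectedComponentIn (pullBack h S) x ⊆ pullBack h S := connectedComponentIn_subset _ _
  have hsub' : connectedComponentIn S (h x) ⊆ S := connectedComponentIn_subset _ _
  apply Subset.antisymm
  · intro z hz
    refine ⟨(hsub hz).1, ?_⟩
    refine (isPreconnected_connectedComponentIn.image h
      (h.continuousOn.mono (hsub.trans fun _ hy => hy.1))).subset_connectedComponentIn
      ⟨x, mem_connectedComponentIn hx, rfl⟩ ?_ ⟨z, hz, rfl⟩
    rintro _ ⟨y, hy, rfl⟩
    exact (hsub hy).2
  · rw [pullBack_eq_image (hsub'.trans hS)]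
    refine (isPreconnected_connectedComponentIn.image h.symm
      (h.symm.continuousOn.mono (hsub'.trans hS))).subset_connectedComponentIn
      ⟨h x, mem_connectedComponentIn hx.2, h.left_inv hx.1⟩ ?_
    rintro _ ⟨y, hy, rfl⟩
    exact ⟨h.map_target (hS (hsub' hy)), by rw [h.right_inv (hS (hsub' hy))]; exact hsub' hy⟩

/-- Compactness keeps the closure from leaving the domain of `h`. -/
theorem closure_pullBack {C : Set ℂ} (hc : IsCompact (closure C)) (hC : closure C ⊆ h.target) :
    closure (pullBack h C) = pullBack h (closure C) := by
  apply Subset.antisymm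
  · refine closure_minimal (fun z hz => ⟨hz.1, subset_closure hz.2⟩) ?_
    rw [pullBack_eq_image hC]
    exact (hc.image_of_continuousOn (h.symm.continuousOn.mono hC)).isClosed
  · rw [pullBack_eq_image hC, pullBack_eq_image (subset_closure.trans hC)]
    exact (h.symm.continuousOn.mono hC).image_closure

theorem interior_pullBack (V : Set ℂ) : interior (pullBack h V) = pullBack h (interior V) := by
  have h1 : pullBack h V = h.source ∩ h ⁻¹' V := rfl
  have h2 : pullBack h (interior V) = h.source ∩ h ⁻¹' interior V := rfl
  rw [h1, h2, interior_inter, h.open_source.interior_eq, h.preimage_interior]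

end PullBack

/-! ### Local behaviour of quadratic-like maps -/

theorem iterPreimage_succ (f : ℂ → ℂ) (U' : Set ℂ) (n : ℕ) (A : Set ℂ) :
    iterPreimage f U' (n + 1) A = {z | z ∈ U' ∧ f z ∈ iterPreimage f U' n A} := by
  ext z
  constructor
  · rintro ⟨h1, h2⟩
    exact ⟨h1 0 (Nat.succ_pos n), fun j hj => h1 (j + 1) (by omega), h2⟩
  · rintro ⟨h1, h2, h3⟩
    refine ⟨fun j hj => ?_, h3⟩
    cases j with
    | zero => exact h1
    | succ j => exact h2 j (by omega)

namespace IsQuadraticLike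

variable {f : ℂ → ℂ} {U' U : Set ℂ}

theorem analyticAt (hf : IsQuadraticLike f U' U) {z : ℂ} (hz : z ∈ U') : AnalyticAt ℂ f z :=
  hf.holo.analyticAt (hf.disk_domain.1.mem_nhds hz)

theorem analyticAt_iterate (hf : IsQuadraticLike f U' U) {n : ℕ} {z : ℂ}
    (hz : z ∈ iterDomain f U' n) : AnalyticAt ℂ f^[n] z := by
  induction n with
  | zero => exact analyticAt_id
  | succ n ih =>
    rw [Function.iterate_succ']
    exact (hf.analyticAt (hz n (Nat.lt_succ_self n))).comp (ih fun j hj => hz j (by omega))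

theorem nhds_le_map (hf : IsQuadraticLike f U' U) {z : ℂ} (hz : z ∈ U') (hz0 : f z ≠ f 0) :
    𝓝 (f z) ≤ map f (𝓝 z) := by
  refine (hf.analyticAt hz).eventually_constant_or_nhds_le_map_nhds.resolve_left fun hcst => ?_
  have hfin : {y | y ∈ U' ∧ f y = f z}.Finite := by
    refine finite_of_ncard_ne_zero ?_
    rw [hf.fiber_two _ (hf.mapsTo hz) hz0]
    norm_num
  refine infinite_of_mem_nhds z ?_ hfin
  filter_upwards [hcst, hf.disk_domain.1.mem_nhds hz] with y hy hyU
  exact ⟨hyU, hy⟩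

/-- A quadratic-like map is locally injective off the critical point. -/
theorem exists_injOn (hf : IsQuadraticLike f U' U) {z : ℂ} (hz : z ∈ U') (hz0 : f z ≠ f 0) :
    ∃ N ∈ 𝓝 z, N ⊆ U' ∧ InjOn f N := by
  have hcard := hf.fiber_two _ (hf.mapsTo hz) hz0
  -- Values near `f z` are also taken near the other preimage `y`, by openness there. Two equal
  -- values near `z` would make a fibre of three points.
  obtain ⟨y, ⟨hyU, hyz⟩, hne⟩ : ∃ y ∈ {y | y ∈ U' ∧ f y = f z}, y ≠ z :=
    exists_ne_of_one_lt_ncard (by rw [hcard]; norm_num) z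
  obtain ⟨M₁, M₂, hM₁, hM₂, hzM, hyM, hdis⟩ := t2_separation hne.symm
  have hU := hf.disk_domain.1
  have h1 := hf.nhds_le_map hyU (by rwa [hyz])
    (image_mem_map (inter_mem (hM₂.mem_nhds hyM) (hU.mem_nhds hyU)))
  rw [hyz] at h1
  have h2 : ∀ᶠ u in 𝓝 z, f u ≠ f 0 := (hf.analyticAt hz).continuousAt.eventually_ne hz0
  have h3 := (hf.analyticAt hz).continuousAt.preimage_mem_nhds h1
  refine ⟨_, inter_mem (inter_mem (inter_mem (hM₁.mem_nhds hzM) (hU.mem_nhds hz)) h2) h3,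
    fun u hu => hu.1.1.2, ?_⟩
  rintro u ⟨⟨⟨huM, huU⟩, hu0⟩, ⟨w, ⟨hwM, hwU⟩, hwu⟩⟩ v ⟨⟨⟨hvM, hvU⟩, -⟩, -⟩ huv
  by_contra huv'
  have hc2 := hf.fiber_two _ (hf.mapsTo huU) hu0
  have hfin : {x | x ∈ U' ∧ f x = f u}.Finite := finite_of_ncard_ne_zero (by rw [hc2]; norm_num)
  have hsub : ({u, v, w} : Set ℂ) ⊆ {x | x ∈ U' ∧ f x = f u} := by
    rintro x (rfl | rfl | rfl)
    exacts [⟨huU, rfl⟩, ⟨hvU, huv.symm⟩, ⟨hwU, hwu⟩]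
  have h4 := ncard_le_ncard hsub hfin
  have h5 : ({u, v, w} : Set ℂ).ncard = 3 := by
    rw [ncard_eq_three]
    exact ⟨u, v, w, huv', hdis.ne_of_mem huM hwM, hdis.ne_of_mem hvM hwM, rfl⟩
  omega

end IsQuadraticLike

theorem filledJulia_subset {f : ℂ → ℂ} {U' : Set ℂ} : filledJulia f U' ⊆ U' := fun _ hz => hz 0

theorem apply_mem_filledJulia {f : ℂ → ℂ} {U' : Set ℂ} {z : ℂ} (hz : z ∈ filledJulia f U') :
    f z ∈ filledJulia f U' := fun n => hz (n + 1)

/-! ### The straightening and the critical point -/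

namespace IsStraightening

variable {f : ℂ → ℂ} {U' U : Set ℂ} {c : ℂ} {h : OpenPartialHomeomorph ℂ ℂ} {B : ℂ → ℂ} {r : ℝ}

theorem apply_notMem_basinInfty (hh : IsStraightening f U' c h) {z : ℂ}
    (hz : z ∈ filledJulia f U') : h z ∉ basinInfty c := by
  have : h z ∈ (basinInfty c)ᶜ := hh.image_filledJulia ▸ mem_image_of_mem h hz
  exact this

theorem conj_of_mem_filledJulia (hh : IsStraightening f U' c h) {z : ℂ}
    (hz : z ∈ filledJulia f U') : h (f z) = quadPoly c (h z) :=
  hh.conj z (hh.subset_source hz) (filledJulia_subset hz)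
    (hh.subset_source (apply_mem_filledJulia hz))

/-- A straightening maps the critical point to the critical point. -/
theorem exists_apply_eq_zero (hh : IsStraightening f U' c h) (hf : IsQuadraticLike f U' U)
    (hB : IsBottcher c B) : (0 : ℂ) ∈ filledJulia f U' ∧ h 0 = 0 := by
  obtain ⟨ζ, hζ, hζ0⟩ : (0 : ℂ) ∈ h '' filledJulia f U' := by
    rw [hh.image_filledJulia]
    exact hB.zero_notMem
  suffices hζz : ζ = 0 by rw [hζz] at hζ hζ0; exact ⟨hζ, hζ0⟩
  have hζU := filledJulia_subset hζ
  have hζs := hh.subset_source hζ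
  -- As `h` is only a homeomorphism, derivatives are useless. Off the critical point $f$ is locally
  -- injective, whereas $\pm y$ near $0$ have equal images under the polynomial.
  by_contra hne
  have hf0 : f ζ ≠ f 0 := fun heq => hne (hf.fiber_crit ζ hζU heq)
  obtain ⟨N, hN, hNU, hinj⟩ := hf.exists_injOn hζU hf0
  have h0t : (0 : ℂ) ∈ h.target := hζ0 ▸ h.map_source hζs
  have hsymm0 : h.symm 0 = ζ := by rw [← hζ0, h.left_inv hζs]
  have hev : ∀ᶠ y in 𝓝 (0 : ℂ), y ∈ h.target ∧ h.symm y ∈ N ∧ f (h.symm y) ∈ h.source := by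
    have hc : Tendsto h.symm (𝓝 0) (𝓝 ζ) := by
      have := (h.symm.continuousAt (x := 0) h0t).tendsto
      rwa [hsymm0] at this
    have hfc := (hf.analyticAt hζU).continuousAt.preimage_mem_nhds
      (h.open_source.mem_nhds (hh.subset_source (apply_mem_filledJulia hζ)))
    exact (h.open_target.eventually_mem h0t).and ((hc.eventually hN).and (hc.eventually hfc))
  have hevn : ∀ᶠ y in 𝓝 (0 : ℂ), -y ∈ h.target ∧ h.symm (-y) ∈ N ∧ f (h.symm (-y)) ∈ h.source := by
    have : Tendsto (fun y : ℂ => -y) (𝓝 0) (𝓝 0) := by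
      simpa using (continuous_neg (G := ℂ)).tendsto 0
    exact this.eventually hev
  obtain ⟨y, ⟨⟨h1, h2, h3⟩, h4, h5, h6⟩, hy0⟩ :=
    (((hev.and hevn).filter_mono nhdsWithin_le_nhds).and
      (self_mem_nhdsWithin : {(0 : ℂ)}ᶜ ∈ 𝓝[≠] 0)).exists
  have e1 := hh.conj _ (h.map_target h1) (hNU h2) h3
  have e2 := hh.conj _ (h.map_target h4) (hNU h5) h6
  rw [h.right_inv h1] at e1
  rw [h.right_inv h4, quadPoly_neg] at e2
  have e3 := hinj h2 h5 (h.injOn h3 h6 (e1.trans e2.symm))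
  have e4 := h.symm.injOn h1 h4 e3
  exact hy0 (self_eq_neg.1 e4)

end IsStraightening

/-! ### The dictionary between the two puzzles -/

namespace IsAdmissibleLevel

variable {f : ℂ → ℂ} {U' U : Set ℂ} {c : ℂ} {h : OpenPartialHomeomorph ℂ ℂ} {B : ℂ → ℂ} {r : ℝ}
  {α : ℂ}

theorem closedLevelRegion_subset_target (hr : IsAdmissibleLevel f U' c h B r) :
    closedLevelRegion c B r ⊆ h.target := by
  have hmono : closedLevelRegion c B r ⊆ closedLevelRegion c B (r ^ 2) := fun z hz hzb =>
    (hz hzb).trans (le_self_pow₀ hr.one_lt.le two_ne_zero)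
  exact hmono.trans hr.subset_target

theorem conj (hr : IsAdmissibleLevel f U' c h B r) (hh : IsStraightening f U' c h) {z : ℂ}
    (hz : z ∈ closedRegion c h B r) :
    z ∈ U' ∧ f z ∈ h.source ∧ h (f z) = quadPoly c (h z) := by
  have h1 := hr.subset_domain hz
  have h2 := (hr.mapsTo hz).1
  exact ⟨h1, h2, hh.conj z hz.1 h1 h2⟩

/-- The closed region bounded by the equipotential is backward invariant. -/
theorem mem_closedRegion_of_apply_mem (hr : IsAdmissibleLevel f U' c h B r)
    (hf : IsQuadraticLike f U' U) (hh : IsStraightening f U' c h) (hB : IsBottcher c B) {z : ℂ}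
    (hz : z ∈ U') (hfz : f z ∈ closedRegion c h B r) : z ∈ closedRegion c h B r := by
  obtain ⟨hK0, h00⟩ := hh.exists_apply_eq_zero hf hB
  have h0R : (0 : ℂ) ∈ closedRegion c h B r :=
    ⟨hh.subset_source hK0, fun hb => (hB.zero_notMem (h00 ▸ hb)).elim⟩
  -- The point `z` is not yet known to lie in the domain of `h`. The two polynomial preimages $\pm
  -- y$ lift to points of the region over `f z`; off the critical value they exhaust its fibre of
  -- two points, so `z` is one of them.
  obtain ⟨y, hy⟩ := exists_quadPoly_eq c (h (f z))
  have hlift : ∀ x, quadPoly c x = h (f z) →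
      h.symm x ∈ closedRegion c h B r ∧ h (h.symm x) = x ∧ f (h.symm x) = f z := by
    intro x hx
    have hxL : x ∈ closedLevelRegion c B r :=
      hB.mem_closedLevelRegion_of_quadPoly_mem (by rw [hx]; exact hfz.2)
    have hxt := hr.closedLevelRegion_subset_target hxL
    have hxi := h.right_inv hxt
    have hxR : h.symm x ∈ closedRegion c h B r := ⟨h.map_target hxt, by rwa [hxi]⟩
    obtain ⟨-, h2, h3⟩ := hr.conj hh hxR
    refine ⟨hxR, hxi, h.injOn h2 hfz.1 ?_⟩
    rw [h3, hxi, hx]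
  obtain ⟨hy1, hy2, hy3⟩ := hlift y hy
  obtain ⟨hn1, hn2, hn3⟩ := hlift (-y) (by rw [quadPoly_neg, hy])
  by_cases hv : f z = f 0
  · rw [hf.fiber_crit z hz hv]
    exact h0R
  have hyne : h.symm y ≠ h.symm (-y) := by
    intro heq
    have h1 : y = 0 := self_eq_neg.1 (by rw [← hn2, ← heq, hy2])
    have h2 : h.symm y = 0 := by
      refine h.injOn hy1.1 h0R.1 ?_
      rw [hy2, h00, h1]
    exact hv (by rw [← hy3, h2])
  have hcard := hf.fiber_two _ (hf.mapsTo hz) hv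
  have hfin : {x | x ∈ U' ∧ f x = f z}.Finite := finite_of_ncard_ne_zero (by rw [hcard]; norm_num)
  have hpair : ({h.symm y, h.symm (-y)} : Set ℂ) ⊆ {x | x ∈ U' ∧ f x = f z} := by
    rintro x (rfl | rfl)
    exacts [⟨hr.subset_domain hy1, hy3⟩, ⟨hr.subset_domain hn1, hn3⟩]
  have heq := eq_of_subset_of_ncard_le hpair (by rw [hcard, ncard_pair hyne]) hfin
  have hmem : z ∈ ({h.symm y, h.symm (-y)} : Set ℂ) := by
    rw [heq]
    exact ⟨hz, rfl⟩
  rcases hmem with rfl | rfl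
  exacts [hy1, hn1]

theorem iterate_mem_closedLevelRegion (hB : IsBottcher c B) {n : ℕ} {w : ℂ}
    (hw : (quadPoly c)^[n] w ∈ closedLevelRegion c B r) : w ∈ closedLevelRegion c B r := by
  induction n with
  | zero => exact hw
  | succ n ih =>
    rw [Function.iterate_succ_apply'] at hw
    exact ih (hB.mem_closedLevelRegion_of_quadPoly_mem hw)

theorem iterPreimage_pullBack (hr : IsAdmissibleLevel f U' c h B r) (hf : IsQuadraticLike f U' U)
    (hh : IsStraightening f U' c h) (hB : IsBottcher c B) {A : Set ℂ}
    (hA : A ⊆ closedLevelRegion c B r) (n : ℕ) :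
    iterPreimage f U' n (pullBack h A) = pullBack h ((quadPoly c)^[n] ⁻¹' A) := by
  induction n with
  | zero =>
    ext z
    exact ⟨fun hz => hz.2, fun hz => ⟨fun j hj => (Nat.not_lt_zero j hj).elim, hz⟩⟩
  | succ n ih =>
    rw [iterPreimage_succ, ih]
    ext z
    constructor
    · rintro ⟨hzU, hfz⟩
      have hzR := hr.mem_closedRegion_of_apply_mem hf hh hB hzU
        ⟨hfz.1, iterate_mem_closedLevelRegion hB (hA hfz.2)⟩
      refine ⟨hzR.1, ?_⟩
      rw [mem_preimage, Function.iterate_succ_apply, ← (hr.conj hh hzR).2.2]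
      exact hfz.2
    · rintro ⟨hzs, hz⟩
      obtain ⟨h1, h2, h3⟩ := hr.conj hh (z := z) ⟨hzs, iterate_mem_closedLevelRegion hB (hA hz)⟩
      refine ⟨h1, h2, ?_⟩
      rw [h3]
      exact hz

/-- Levels grow along orbits, so a bound on the last point keeps all earlier ones in the region
where the conjugacy holds. -/
theorem apply_iterate (hr : IsAdmissibleLevel f U' c h B r) (hh : IsStraightening f U' c h)
    (hB : IsBottcher c B) {n : ℕ} {z : ℂ} (hz : z ∈ h.source)
    (hzn : (quadPoly c)^[n] (h z) ∈ closedLevelRegion c B r) :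
    f^[n] z ∈ h.source ∧ h (f^[n] z) = (quadPoly c)^[n] (h z) := by
  induction n with
  | zero => exact ⟨hz, rfl⟩
  | succ n ih =>
    rw [Function.iterate_succ_apply'] at hzn
    have h1 := hB.mem_closedLevelRegion_of_quadPoly_mem hzn
    obtain ⟨h2, h3⟩ := ih h1
    obtain ⟨-, h4, h5⟩ := hr.conj hh (z := f^[n] z) ⟨h2, by rwa [h3]⟩
    rw [Function.iterate_succ_apply', Function.iterate_succ_apply', h5, h3]
    exact ⟨h4, rfl⟩

theorem cutRegion_eq_pullBack (hα : α ∈ h.source) :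
    cutRegion c h B α r = pullBack h (polyCutRegion c B (h α) r) := by
  ext z
  constructor
  · rintro ⟨h1, h2, h3, h4⟩
    exact ⟨h1, h2, fun heq => h3 (h.injOn h1 hα heq), h4⟩
  · rintro ⟨h1, h2, h3, h4⟩
    exact ⟨h1, h2, fun heq => h3 (congrArg h heq), h4⟩

theorem isPuzzlePieceZero_iff (hr : IsAdmissibleLevel f U' c h B r) (hα : α ∈ h.source)
    (ha : IsCutPoint c B (h α)) {Y : Set ℂ} :
    IsPuzzlePieceZero c h B α r Y ↔ ∃ Y', IsPolyPieceZero c B (h α) r Y' ∧ Y = pullBack h Y' := by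
  have hG : polyCutRegion c B (h α) r ⊆ h.target := fun z hz =>
    hr.closedLevelRegion_subset_target fun hzb => (hz.1 hzb).le
  have key : ∀ x ∈ pullBack h (polyCutRegion c B (h α) r),
      closure (connectedComponentIn (cutRegion c h B α r) x) =
        pullBack h (closure (connectedComponentIn (polyCutRegion c B (h α) r) (h x))) := by
    intro x hx
    have hY : IsPolyPieceZero c B (h α) r _ := ⟨h x, hx.2, rfl⟩
    rw [cutRegion_eq_pullBack hα, connectedComponentIn_pullBack hG hx]
    exact closure_pullBack (hY.isCompact ha)
      ((hY.subset_closedLevelRegion ha).trans hr.closedLevelRegion_subset_target)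
  constructor
  · rintro ⟨x, hx, rfl⟩
    rw [cutRegion_eq_pullBack hα] at hx
    exact ⟨_, ⟨h x, hx.2, rfl⟩, key x hx⟩
  · rintro ⟨_, ⟨y, hy, rfl⟩, rfl⟩
    have hi := h.right_inv (hG hy)
    have hx : h.symm y ∈ pullBack h (polyCutRegion c B (h α) r) :=
      ⟨h.map_target (hG hy), by rwa [hi]⟩
    refine ⟨h.symm y, by rwa [cutRegion_eq_pullBack hα], ?_⟩
    rw [key _ hx, hi]

/-- The puzzle pieces of `f` correspond to those of the polynomial. -/
theorem isPuzzlePiece_iff (hr : IsAdmissibleLevel f U' c h B r) (hf : IsQuadraticLike f U' U)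
    (hh : IsStraightening f U' c h) (hα : α ∈ h.source) (ha : IsCutPoint c B (h α)) {V : Set ℂ} :
    IsPuzzlePiece f U' c h B α r V ↔
      ∃ n Y' V', IsPolyPiece c B (h α) r n Y' V' ∧ V = pullBack h V' := by
  have hsub : ∀ {n Y'}, IsPolyPieceZero c B (h α) r Y' → (quadPoly c)^[n] ⁻¹' Y' ⊆ h.target :=
    fun hY' => (hY'.preimage_subset_closedLevelRegion ha _).trans
      hr.closedLevelRegion_subset_target
  constructor
  · rintro ⟨n, Y, hY, x, hx, rfl⟩
    obtain ⟨Y', hY', rfl⟩ := (hr.isPuzzlePieceZero_iff hα ha).1 hY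
    rw [hr.iterPreimage_pullBack hf hh ha.bottcher (hY'.subset_closedLevelRegion ha)] at hx ⊢
    exact ⟨n, Y', _, ⟨hY', h x, hx.2, rfl⟩, connectedComponentIn_pullBack (hsub hY') hx⟩
  · rintro ⟨n, Y', V', ⟨hY', y, hy, rfl⟩, rfl⟩
    have hi := h.right_inv (hsub hY' hy)
    have hx : h.symm y ∈ pullBack h ((quadPoly c)^[n] ⁻¹' Y') :=
      ⟨h.map_target (hsub hY' hy), by rwa [hi]⟩
    refine ⟨n, pullBack h Y', (hr.isPuzzlePieceZero_iff hα ha).2 ⟨Y', hY', rfl⟩, h.symm y, ?_⟩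
    rw [hr.iterPreimage_pullBack hf hh ha.bottcher (hY'.subset_closedLevelRegion ha),
      connectedComponentIn_pullBack (hsub hY') hx, hi]
    exact ⟨hx, rfl⟩

end IsAdmissibleLevel

/-! ### The dividing fixed point and the conclusion -/

theorem isCutPoint_of_hasRotationNumber {f : ℂ → ℂ} {U' U : Set ℂ} (hf : IsQuadraticLike f U' U)
    (hrep : ∀ a ∈ U', f a = a → 1 < ‖deriv f a‖) {c : ℂ} {h : OpenPartialHomeomorph ℂ ℂ}
    (hh : IsStraightening f U' c h) {B : ℂ → ℂ} (hB : IsBottcher c B) {α : ℂ} {q p : ℕ}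
    (hα : HasRotationNumber f U' c h B α q p) :
    α ∈ filledJulia f U' ∧ IsCutPoint c B (h α) := by
  obtain ⟨hαU, hfix, -, θ, -, -, hθ, -⟩ := hα
  have hαK : α ∈ filledJulia f U' := fun n => by rwa [Function.iterate_fixed hfix]
  refine ⟨hαK, hB, ?_, hh.apply_notMem_basinInfty hαK, ?_, ?_⟩
  · rw [← hh.conj_of_mem_filledJulia hαK, hfix]
  -- The fixed point is repelling, whereas the derivative vanishes at the critical point.
  · intro h0
    obtain ⟨h0K, h00⟩ := hh.exists_apply_eq_zero hf hB
    have : α = 0 := h.injOn (hh.subset_source hαK) (hh.subset_source h0K) (h0.trans h00.symm)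
    have h1 := hrep α hαU hfix
    rw [this, hf.deriv_zero, norm_zero] at h1
    linarith
  · refine (finite_range θ).subset ?_
    rintro t ⟨ht, hl⟩
    exact (hθ t ht).1 hl

/-- The data are moved to the polynomial and the resulting `Ω` is pulled back. Injectivity and the
image transfer through `h`; analyticity does not, and comes from $f$ being analytic along the orbit.
-/
theorem lemma3p5
    (f : ℂ → ℂ) (U' U : Set ℂ) (hf : IsQuadraticLike f U' U)
    (hK : IsConnected (filledJulia f U'))
    (hrep : ∀ a ∈ U', f a = a → 1 < ‖deriv f a‖)
    (c : ℂ) (h : OpenPartialHomeomorph ℂ ℂ) (hh : IsStraightening f U' c h)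
    (B : ℂ → ℂ) (hB : IsBottcher c B)
    (α : ℂ) (q p : ℕ) (hp : 1 < p) (hα : HasRotationNumber f U' c h B α q p)
    (r : ℝ) (hr : IsAdmissibleLevel f U' c h B r)
    (V V₀ : Set ℂ) (hV : IsPuzzlePiece f U' c h B α r V)
    (hV₀ : IsCentralDomain f U' c h B α r V V₀)
    (z : ℂ) (hz : ∃ k, z ∈ iterPreimage f U' k (interior V₀))
    (l : ℕ) (hl : IsLeast {k | z ∈ iterPreimage f U' k V₀} l) :
    ∃ Ω : Set ℂ, IsPuzzlePiece f U' c h B α r Ω ∧ z ∈ Ω ∧ MapsUnivalentlyOnto f U' l Ω V := by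
  obtain ⟨hαK, ha⟩ := isCutPoint_of_hasRotationNumber hf hrep hh hB hα
  have hαs := hh.subset_source hαK
  obtain ⟨hK0, h00⟩ := hh.exists_apply_eq_zero hf hB
  obtain ⟨hV₀p, h0V₀, hsub, k, hk, hdom, himg⟩ := hV₀
  obtain ⟨n, Y, W, hW, rfl⟩ := (hr.isPuzzlePiece_iff hf hh hαs ha).1 hV
  obtain ⟨N, Y₀, W₀, hW₀, rfl⟩ := (hr.isPuzzlePiece_iff hf hh hαs ha).1 hV₀p
  have hWL : W ⊆ closedLevelRegion c B r :=
    hW.subset_preimage.trans (hW.1.preimage_subset_closedLevelRegion ha n)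
  have hW₀L : W₀ ⊆ closedLevelRegion c B r :=
    hW₀.subset_preimage.trans (hW₀.1.preimage_subset_closedLevelRegion ha N)
  have hT := hr.closedLevelRegion_subset_target
  have hWsub : W₀ ⊆ W := by
    rw [← image_pullBack (hW₀L.trans hT), ← image_pullBack (hWL.trans hT)]
    exact image_mono hsub
  have hWimg : (quadPoly c)^[k] '' W₀ = W := by
    have hstep : ∀ x ∈ pullBack h W₀, h (f^[k] x) = (quadPoly c)^[k] (h x) := by
      intro x hx
      have h1 : x ∈ iterPreimage f U' k (pullBack h W) :=
        ⟨hdom hx, himg ▸ mem_image_of_mem _ hx⟩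
      rw [hr.iterPreimage_pullBack hf hh hB hWL] at h1
      exact (hr.apply_iterate hh hB h1.1 (hWL h1.2)).2
    rw [← image_pullBack (hW₀L.trans hT), ← image_pullBack (hWL.trans hT), ← himg, image_image,
      image_image]
    exact image_congr fun x hx => (hstep x hx).symm
  have hkW : IsLeast {k | 0 < k ∧ (quadPoly c)^[k] 0 ∈ interior W} k := by
    have heq : {k | 0 < k ∧ (0 : ℂ) ∈ iterPreimage f U' k (interior (pullBack h W))} =
        {k | 0 < k ∧ (quadPoly c)^[k] 0 ∈ interior W} := by
      ext j
      rw [mem_ofPred_eq, mem_ofPred_eq, interior_pullBack,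
        hr.iterPreimage_pullBack hf hh hB (interior_subset.trans hWL)]
      refine and_congr_right fun _ => ⟨fun h1 => ?_, fun h1 => ⟨hh.subset_source hK0, ?_⟩⟩
      · have := h1.2
        rwa [h00] at this
      · rwa [h00]
    rw [← heq]
    exact hk.2
  have hlset : {k | z ∈ iterPreimage f U' k (pullBack h W₀)} =
      {k | z ∈ pullBack h ((quadPoly c)^[k] ⁻¹' W₀)} := by
    ext j
    rw [mem_ofPred_eq, mem_ofPred_eq, hr.iterPreimage_pullBack hf hh hB hW₀L]
  rw [hlset] at hl
  have hzs : z ∈ h.source := hl.1.1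
  obtain ⟨Ω, hΩ, hzΩ, hinj, himgΩ⟩ := hW.injOn_and_image_eq hW₀ ha hr.one_lt hkW (h00 ▸ h0V₀.2)
    hWsub hWimg (z := h z) ⟨hl.1.2, fun j hj => hl.2 ⟨hzs, hj⟩⟩
  have hΩpre : Ω ⊆ (quadPoly c)^[l] ⁻¹' W := fun w hw => himgΩ ▸ mem_image_of_mem _ hw
  have hΩsub : pullBack h Ω ⊆ iterPreimage f U' l (pullBack h W) := by
    rw [hr.iterPreimage_pullBack hf hh hB hWL]
    exact fun x hx => ⟨hx.1, hΩpre hx.2⟩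
  have hconj : ∀ x ∈ pullBack h Ω, f^[l] x ∈ h.source ∧ h (f^[l] x) = (quadPoly c)^[l] (h x) :=
    fun x hx => hr.apply_iterate hh hB hx.1 (hWL (hΩpre hx.2))
  have hΩT : Ω ⊆ h.target :=
    (hΩ.subset_preimage.trans (hΩ.1.preimage_subset_closedLevelRegion ha _)).trans hT
  refine ⟨pullBack h Ω, (hr.isPuzzlePiece_iff hf hh hαs ha).2 ⟨_, _, _, hΩ, rfl⟩, ⟨hzs, hzΩ⟩,
    fun x hx => (hΩsub hx).1, fun x hx => hf.analyticAt_iterate (hΩsub hx).1, ?_, ?_⟩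
  · intro x hx y hy hxy
    refine h.injOn hx.1 hy.1 (hinj hx.2 hy.2 ?_)
    rw [← (hconj x hx).2, ← (hconj y hy).2, hxy]
  · refine Subset.antisymm (image_subset_iff.2 fun x hx => (hΩsub hx).2) ?_
    rintro y ⟨hys, hyW⟩
    obtain ⟨w, hw, hwy⟩ := himgΩ.symm.subset hyW
    have hwi := h.right_inv (hΩT hw)
    have hx : h.symm w ∈ pullBack h Ω := ⟨h.map_target (hΩT hw), by rwa [hwi]⟩
    refine ⟨_, hx, h.injOn (hconj _ hx).1 hys ?_⟩
    rw [(hconj _ hx).2, hwi, hwy]
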